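/- Let $\mathbb{G}=\mathrm{Aut}(\mathbf{R},<)$ be the group of order-preserving self-bijections of the real line, with the topology in which the pointwise stabilizers of finite subsets of $\mathbf{R}$ form a neighbourhood basis of the identity. Let $\mathbf{S}(\mathbb{G})$ be the category whose objects are the sets with an action of $\mathbb{G}$ such that every point has an open stabilizer and there are finitely many orbits, and whose morphisms are the $\mathbb{G}$-equivariant maps. For $n\ge 0$ let $\mathbf{R}^{(n)}$ be the $\mathbb{G}$-set of tuples $(x_1,\dots,x_n)\in\mathbf{R}^n$ with $x_1<\cdots<x_n$. Let $\mathcal{S}$ be a lextensive category, i.e. a (finitely) extensive category with finite limits. A (totally) ordered object of $\mathcal{S}$ is a pair $(X,R_X)$ of an object $X$ and a subobject $R_X\subset X\times X$ that is total, meaning that the natural map $R_X\amalg\Delta_X\amalg R_X^{\mathrm{op}}\to X\times X$ is an isomorphism (where $\Delta_X$ is the diagonal and $R_X^{\mathrm{op}}$ is the image of $R_X$ under the switching map), and transitive, meaning that $R_{12}\cap R_{23}\subset R_{13}$ in $X^3$, where $R_{ij}$ is the inverse image of $R_X$ under the projection $p_{ij}\colon X^3\to X^2$. A morphism $f\colon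 X\to Y$ of ordered objects is monotonic if $R_X\subset (f\times f)^{-1}(R_Y)$. Let $\mathrm{Ord}(\mathcal{S})$ be the category of ordered objects and monotonic morphisms. For an ordered object $X$ and $n\ge 0$, let $X^{(n)}\subset X^n$ be the intersection, over all $1\le i<j\le n$, of the inverse images of $R_X$ under the projections $(p_i,p_j)\colon X^n\to X^2$ (so $X^{(0)}=\mathbf{1}$ is the final object and $X^{(1)}=X$). Call $X$ infinite-like if $X^{(n)}$ is not an initial object for any $n\ge 0$. Let $\mathrm{LEx}^{\oplus}(\mathbf{S}(\mathbb{G}),\mathcal{S})$ be the category of functors $\Psi\colon\mathbf{S}(\mathbb{G})\to\mathcal{S}$ that are additive (preserve finite coproducts) and left-exact (preserve finite limits), with all natural transformations as morphisms. For such $\Psi$, the object $\Psi(\mathbf{R})$ is an ordered object of $\mathcal{S}$, with the order $\Psi(\mathbf{R}^{(2)})\subset\Psi(\mathbf{R}\times\mathbf{R})=\Psi(\mathbf{R})\times\Psi(\mathbf{R})$. (a) The functor $$\mathrm{LEx}^{\oplus}(\mathbf{S}(\mathbb{G}),\mathcal{S})\to\mathrm{Ord}(\mathcal{S}),\qquad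 \Psi\mapsto\Psi(\mathbf{R}),\quad \eta\mapsto\eta_{\mathbf{R}},$$ is an equivalence of categories. (b) A functor $\Psi$ in $\mathrm{LEx}^{\oplus}(\mathbf{S}(\mathbb{G}),\mathcal{S})$ is faithful if and only if the ordered object $\Psi(\mathbf{R})$ is infinite-like. -/

import Mathlib

open CategoryTheory CategoryTheory.Limits

universe v u

namespace Delannoy

/-! ### The category `𝐒(G)` of smooth finitary `G`-sets -/

/-- The topology of a permutation group `(G, Ω)`: the pointwise stabilizers `G(A)` of the finite
subsets `A` of `Ω` form a neighbourhood basis of the identity. A set `U` is open if with each `g`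
it contains a coset `g G(A) = {h | ∀ a ∈ A, h a = g a}`. -/
abbrev permTopology (G Ω : Type) [Group G] [MulAction G Ω] : TopologicalSpace G where
  IsOpen U := ∀ g ∈ U, ∃ A : Finset Ω, ∀ h : G, (∀ a ∈ A, h • a = g • a) → h ∈ U
  isOpen_univ := fun _ _ => ⟨∅, fun _ _ => Set.mem_univ _⟩
  isOpen_inter := by
    classical
    intro U V hU hV g hg
    obtain ⟨A, hA⟩ := hU g hg.1
    obtain ⟨B, hB⟩ := hV g hg.2
    exact ⟨A ∪ B, fun h hh => ⟨hA h fun a ha => hh a (Finset.mem_union_left _ ha),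
      hB h fun a ha => hh a (Finset.mem_union_right _ ha)⟩⟩
  isOpen_sUnion := by
    intro s hs g hg
    obtain ⟨U, hU, hgU⟩ := hg
    obtain ⟨A, hA⟩ := hs U hU g hgU
    exact ⟨A, fun h hh => ⟨U, hU, hA h hh⟩⟩

/-- A `G`-set: a set with an action of the topological group `G` that is smooth (every point has
an open stabilizer) and finitary (there are finitely many orbits). -/
structure GSet (G : Type) [Group G] [TopologicalSpace G] : Type 1 where
  carrier : Type
  [action : MulAction G carrier]
  smooth : ∀ x : carrier, IsOpen (MulAction.stabilizer G x : Set G)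
  finitary : Finite (MulAction.orbitRel.Quotient G carrier)

attribute [instance] GSet.action

section GSet

variable {G : Type} [Group G] [TopologicalSpace G]

/-- A morphism of `G`-sets: a `G`-equivariant map. -/
@[ext]
structure GSet.Hom (X Y : GSet G) : Type where
  toFun : X.carrier → Y.carrier
  map_smul : ∀ (g : G) (x : X.carrier), toFun (g • x) = g • toFun x

/-- The category `𝐒(G)`. -/
instance : Category (GSet G) where
  Hom := GSet.Hom
  id X := ⟨fun x => x, fun _ _ => rfl⟩
  comp f g := ⟨fun x => g.toFun (f.toFun x), fun a x => by rw [f.map_smul, g.map_smul]⟩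

theorem GSet.hom_ext {X Y : GSet G} {f g : X ⟶ Y}
    (h : ∀ x, GSet.Hom.toFun f x = GSet.Hom.toFun g x) : f = g :=
  GSet.Hom.ext (funext h)

theorem GSet.comp_toFun {X Y Z : GSet G} (f : X ⟶ Y) (g : Y ⟶ Z) (x : X.carrier) :
    GSet.Hom.toFun (f ≫ g) x = GSet.Hom.toFun g (GSet.Hom.toFun f x) := rfl

theorem GSet.mono_of_injective {X Y : GSet G} (f : X ⟶ Y)
    (hf : Function.Injective (GSet.Hom.toFun f)) : Mono f where
  right_cancellation _ _ e := GSet.hom_ext fun x => hf (congrArg (fun k => GSet.Hom.toFun k x) e)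

/-- Two injective equivariant maps with complementary images exhibit a coproduct. -/
theorem GSet.isColimit_of_compl {X Y Z : GSet G} (f : X ⟶ Z) (g : Y ⟶ Z)
    (hf : Function.Injective (GSet.Hom.toFun f)) (hg : Function.Injective (GSet.Hom.toFun g))
    (hd : ∀ x y, GSet.Hom.toFun f x ≠ GSet.Hom.toFun g y)
    (hs : ∀ z, (∃ x, GSet.Hom.toFun f x = z) ∨ ∃ y, GSet.Hom.toFun g y = z) :
    Nonempty (IsColimit (BinaryCofan.mk f g)) := by
  classical
  have key : ∀ {W : GSet G} (a : X ⟶ W) (b : Y ⟶ W), ∃ c : Z ⟶ W, f ≫ c = a ∧ g ≫ c = b := by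
    intro W a b
    have : ∀ z, ∃ w, (∀ x, GSet.Hom.toFun f x = z → w = GSet.Hom.toFun a x) ∧
        ∀ y, GSet.Hom.toFun g y = z → w = GSet.Hom.toFun b y := by
      intro z
      rcases hs z with ⟨x, hx⟩ | ⟨y, hy⟩
      · refine ⟨GSet.Hom.toFun a x, fun x' hx' => ?_, fun y' hy' => ?_⟩
        · rw [hf (hx.trans hx'.symm)]
        · exact absurd (hx.trans hy'.symm) (hd _ _)
      · refine ⟨GSet.Hom.toFun b y, fun x' hx' => ?_, fun y' hy' => ?_⟩
        · exact absurd (hx'.trans hy.symm) (hd _ _)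
        · rw [hg (hy.trans hy'.symm)]
    choose c hc using this
    refine ⟨⟨c, fun s z => ?_⟩, GSet.hom_ext fun x => (hc _).1 x rfl,
      GSet.hom_ext fun y => (hc _).2 y rfl⟩
    rcases hs z with ⟨x, hx⟩ | ⟨y, hy⟩
    · rw [(hc z).1 x hx, (hc (s • z)).1 (s • x) (by rw [GSet.Hom.map_smul f, hx]),
        GSet.Hom.map_smul a]
    · rw [(hc z).2 y hy, (hc (s • z)).2 (s • y) (by rw [GSet.Hom.map_smul g, hy]),
        GSet.Hom.map_smul b]
  refine ⟨BinaryCofan.isColimitMk (fun s => (key s.inl s.inr).choose)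
    (fun s => (key s.inl s.inr).choose_spec.1) (fun s => (key s.inl s.inr).choose_spec.2) ?_⟩
  intro s m h₁ h₂
  have e₁ := (key s.inl s.inr).choose_spec.1
  have e₂ := (key s.inl s.inr).choose_spec.2
  refine GSet.hom_ext fun z => ?_
  rcases hs z with ⟨x, rfl⟩ | ⟨y, rfl⟩
  · exact congrArg (fun k => GSet.Hom.toFun k x) (h₁.trans e₁.symm)
  · exact congrArg (fun k => GSet.Hom.toFun k y) (h₂.trans e₂.symm)

end GSet

/-! ### The group `𝔾 = Aut(ℝ, <)` and the `𝔾`-sets `ℝ`, `ℝ × ℝ` and `ℝ^(n)` -/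

/-- The group `𝔾 = Aut(ℝ, <)` of order-preserving self-bijections of the real line. -/
abbrev DelannoyGroup : Type := ℝ ≃o ℝ

/-- `𝔾` is topologized as a permutation group of `ℝ`. -/
instance : TopologicalSpace DelannoyGroup := permTopology DelannoyGroup ℝ

theorem delannoy_smul_lt (g : DelannoyGroup) {a b : ℝ} : g • a < g • b ↔ a < b :=
  g.lt_iff_lt

/-- If all `g` that fix a given finite set of reals pointwise fix `x`, then `x` has an open
stabilizer. -/
theorem isOpen_stabilizer {X : Type} [MulAction DelannoyGroup X] (x : X) (A : Finset ℝ)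
    (h : ∀ g : DelannoyGroup, (∀ a ∈ A, g • a = a) → g • x = x) :
    IsOpen (MulAction.stabilizer DelannoyGroup x : Set DelannoyGroup) := by
  intro g hg
  refine ⟨A, fun k hk => ?_⟩
  have h1 : (g⁻¹ * k) • x = x := h _ fun a ha => by rw [mul_smul, hk a ha, inv_smul_smul]
  have h2 : k • x = g • x := by rw [mul_smul] at h1; rw [← h1, smul_inv_smul]; rw [h1]
  exact h2.trans hg

/-- Strictly increasing `n`-tuples of reals. -/
abbrev IncTuple (n : ℕ) : Type := {x : Fin n → ℝ // StrictMono x}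

instance (n : ℕ) : MulAction DelannoyGroup (IncTuple n) where
  smul g x := ⟨fun i => g • x.1 i, fun _ _ h => (delannoy_smul_lt g).2 (x.2 h)⟩
  one_smul _ := Subtype.ext (funext fun _ => one_smul _ _)
  mul_smul _ _ _ := Subtype.ext (funext fun _ => mul_smul _ _ _)

theorem incTuple_smul_apply {n : ℕ} (g : DelannoyGroup) (x : IncTuple n) (i : Fin n) :
    (g • x).1 i = g • x.1 i := rfl

/-- An automorphism that fixes `(-∞, c]` and maps `a` to `b`, for `a, b > c`. -/
theorem exists_fix_le_map (c a b : ℝ) (ha : c < a) (hb : c < b) :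
    ∃ g : DelannoyGroup, (∀ t ≤ c, g • t = t) ∧ g • a = b := by
  have hl : 0 < (b - c) / (a - c) := div_pos (by linarith) (by linarith)
  set l := (b - c) / (a - c) with hldef
  have hmono : StrictMono fun t : ℝ => if t ≤ c then t else c + (t - c) * l := by
    intro s t hst
    by_cases hs : s ≤ c <;> by_cases ht : t ≤ c <;> simp only [hs, ht, if_true, if_false]
    · exact hst
    · have := mul_pos (sub_pos.2 (not_le.1 ht)) hl
      linarith
    · linarith
    · have := mul_lt_mul_of_pos_right (show s - c < t - c by linarith) hl
      linarith
  have hsurj : Function.Surjective fun t : ℝ => if t ≤ c then t else c + (t - c) * l := by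
    intro y
    by_cases hy : y ≤ c
    · exact ⟨y, by simp [hy]⟩
    · have h1 : ¬ (c + (y - c) / l ≤ c) := by
        have := div_pos (sub_pos.2 (not_le.1 hy)) hl
        linarith
      refine ⟨c + (y - c) / l, ?_⟩
      simp only [h1, if_false]
      field_simp
      ring
  refine ⟨hmono.orderIsoOfSurjective _ hsurj, fun t ht => ?_, ?_⟩
  · change (if t ≤ c then t else c + (t - c) * l) = t
    simp [ht]
  · change (if a ≤ c then a else c + (a - c) * l) = b
    have h3 : a - c ≠ 0 := by linarith
    rw [if_neg (not_le.2 ha), hldef]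
    field_simp
    ring

/-- `𝔾` acts transitively on the strictly increasing `n`-tuples. -/
theorem incTuple_transitive (n : ℕ) (x y : IncTuple n) : ∃ g : DelannoyGroup, g • x = y := by
  induction n with
  | zero => exact ⟨1, Subtype.ext (funext fun i => i.elim0)⟩
  | succ n ih =>
    obtain ⟨g, hg⟩ := ih ⟨fun i => x.1 i.castSucc, fun _ _ h => x.2 (Fin.castSucc_lt_castSucc_iff.2 h)⟩
      ⟨fun i => y.1 i.castSucc, fun _ _ h => y.2 (Fin.castSucc_lt_castSucc_iff.2 h)⟩
    have hg' : ∀ i : Fin n, g • x.1 i.castSucc = y.1 i.castSucc := fun i =>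
      congrFun (congrArg Subtype.val hg) i
    have hc : ∃ c : ℝ, (∀ i : Fin n, y.1 i.castSucc ≤ c) ∧ c < g • x.1 (Fin.last n) ∧
        c < y.1 (Fin.last n) := by
      rcases n with _ | n
      · exact ⟨min (g • x.1 (Fin.last 0)) (y.1 (Fin.last 0)) - 1, fun i => i.elim0,
          by linarith [min_le_left (g • x.1 (Fin.last 0)) (y.1 (Fin.last 0))],
          by linarith [min_le_right (g • x.1 (Fin.last 0)) (y.1 (Fin.last 0))]⟩
      · refine ⟨y.1 (Fin.last n).castSucc, fun i => ?_, ?_, y.2 (Fin.castSucc_lt_last _)⟩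
        · exact y.2.monotone (Fin.castSucc_le_castSucc_iff.2 (Fin.le_last i))
        · rw [← hg']
          exact (delannoy_smul_lt g).2 (x.2 (Fin.castSucc_lt_last _))
    obtain ⟨c, hc1, hc2, hc3⟩ := hc
    obtain ⟨k, hk1, hk2⟩ := exists_fix_le_map c _ _ hc2 hc3
    refine ⟨k * g, Subtype.ext (funext fun i => ?_)⟩
    rw [incTuple_smul_apply, mul_smul]
    induction i using Fin.lastCases with
    | last => exact hk2
    | cast i => rw [hg', hk1 _ (hc1 i)]

/-- A set with finitely many points that meet every orbit is finitary. -/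
theorem finitary_of_reps {X I : Type} [Finite I] [MulAction DelannoyGroup X] (r : I → X)
    (h : ∀ x, ∃ i, ∃ g : DelannoyGroup, g • r i = x) :
    Finite (MulAction.orbitRel.Quotient DelannoyGroup X) := by
  refine Finite.of_surjective (fun i => (Quotient.mk'' (r i) : MulAction.orbitRel.Quotient _ X)) ?_
  intro q
  induction q using Quotient.inductionOn' with
  | h x =>
    obtain ⟨i, g, hg⟩ := h x
    exact ⟨i, Quotient.sound' (MulAction.orbitRel_apply.2 ⟨g⁻¹, by
      change g⁻¹ • x = r i
      rw [← hg, inv_smul_smul]⟩)⟩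

/-- The `𝔾`-set `ℝ^(n)` of strictly increasing `n`-tuples. -/
noncomputable def realInc (n : ℕ) : GSet DelannoyGroup where
  carrier := IncTuple n
  smooth x := by
    classical
    exact isOpen_stabilizer x (Finset.univ.image x.1) fun g hg => Subtype.ext (funext fun i =>
      hg _ (Finset.mem_image_of_mem _ (Finset.mem_univ i)))
  finitary := finitary_of_reps (I := Unit)
    (fun _ => ⟨fun i => (i : ℕ), fun _ _ h => Nat.cast_lt.2 h⟩)
    fun x => ⟨(), incTuple_transitive n _ x⟩

theorem exists_smul_eq_real (a b : ℝ) : ∃ g : DelannoyGroup, g • a = b :=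
  (exists_fix_le_map (min a b - 1) a b (by linarith [min_le_left a b])
    (by linarith [min_le_right a b])).imp fun _ h => h.2

theorem exists_smul_eq_pair {a b c d : ℝ} (h : a < b) (h' : c < d) :
    ∃ g : DelannoyGroup, g • a = c ∧ g • b = d := by
  have hx : StrictMono ![a, b] := by
    rw [Fin.strictMono_iff_lt_succ]; intro i; fin_cases i; simpa using h
  have hy : StrictMono ![c, d] := by
    rw [Fin.strictMono_iff_lt_succ]; intro i; fin_cases i; simpa using h'
  obtain ⟨g, hg⟩ := incTuple_transitive 2 ⟨_, hx⟩ ⟨_, hy⟩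
  have := congrArg Subtype.val hg
  exact ⟨g, congrFun this 0, congrFun this 1⟩

/-- The real line as a `𝔾`-set. -/
def realLine : GSet DelannoyGroup where
  carrier := ℝ
  smooth x := isOpen_stabilizer x {x} fun _ hg => hg _ (Finset.mem_singleton_self x)
  finitary := finitary_of_reps (I := Unit) (fun _ => (0 : ℝ)) fun _ => ⟨(), exists_smul_eq_real _ _⟩

/-- The `𝔾`-set `ℝ × ℝ`. -/
def realPlane : GSet DelannoyGroup where
  carrier := ℝ × ℝ
  smooth x := by
    classical
    exact isOpen_stabilizer x {x.1, x.2} fun g hg => Prod.ext (hg _ (by simp)) (hg _ (by simp))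
  finitary := finitary_of_reps (I := Fin 3) ![((0 : ℝ), (1 : ℝ)), (0, 0), (1, 0)] fun x => by
    rcases lt_trichotomy x.1 x.2 with h | h | h
    · obtain ⟨g, h1, h2⟩ := exists_smul_eq_pair zero_lt_one h
      exact ⟨0, g, Prod.ext h1 h2⟩
    · obtain ⟨g, h1⟩ := exists_smul_eq_real 0 x.1
      exact ⟨1, g, Prod.ext h1 (h1.trans h)⟩
    · obtain ⟨g, h1, h2⟩ := exists_smul_eq_pair zero_lt_one h
      exact ⟨2, g, Prod.ext h2 h1⟩

/-- The first projection `ℝ × ℝ → ℝ`. -/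
def realFst : realPlane ⟶ realLine := GSet.Hom.mk (fun p : ℝ × ℝ => p.1) fun _ _ => rfl

/-- The second projection `ℝ × ℝ → ℝ`. -/
def realSnd : realPlane ⟶ realLine := GSet.Hom.mk (fun p : ℝ × ℝ => p.2) fun _ _ => rfl

/-- The diagonal `ℝ → ℝ × ℝ`. -/
def realDiag : realLine ⟶ realPlane := GSet.Hom.mk (fun x : ℝ => (x, x)) fun _ _ => rfl

/-- The inclusion of the relation `<` of `ℝ`, that is of `ℝ^(2)`, into `ℝ × ℝ`. -/
def realLt : realInc 2 ⟶ realPlane :=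
  GSet.Hom.mk (fun x : IncTuple 2 => (x.1 0, x.1 1)) fun _ _ => rfl

/-- The inclusion of the relation `>` of `ℝ` into `ℝ × ℝ`. -/
def realGt : realInc 2 ⟶ realPlane :=
  GSet.Hom.mk (fun x : IncTuple 2 => (x.1 1, x.1 0)) fun _ _ => rfl

/-- The projection `ℝ^(n) → ℝ^(m)` attached to an order embedding `[m] → [n]`. -/
def realProj {m n : ℕ} (j : Fin m ↪o Fin n) : realInc n ⟶ realInc m :=
  GSet.Hom.mk (fun x : IncTuple n => (⟨fun i => x.1 (j i), fun _ _ h => x.2 (j.strictMono h)⟩ :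
    IncTuple m)) fun _ _ => rfl

theorem realPlane_isLimit : Nonempty (IsLimit (BinaryFan.mk realFst realSnd)) := by
  refine ⟨BinaryFan.IsLimit.mk _
    (fun {T} f g => GSet.Hom.mk (fun t => ((GSet.Hom.toFun f t, GSet.Hom.toFun g t) : ℝ × ℝ))
      fun a t => Prod.ext (GSet.Hom.map_smul f a t) (GSet.Hom.map_smul g a t))
    (fun _ _ => rfl) (fun _ _ => rfl) ?_⟩
  rintro T f g m rfl rfl
  rfl

theorem realLt_injective : Function.Injective (GSet.Hom.toFun realLt) := by
  intro (x : IncTuple 2) (y : IncTuple 2) h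
  have h' : (x.1 0, x.1 1) = (y.1 0, y.1 1) := h
  refine Subtype.ext (funext fun i => ?_)
  fin_cases i
  · exact congrArg Prod.fst h'
  · exact congrArg Prod.snd h'

theorem realGt_injective : Function.Injective (GSet.Hom.toFun realGt) := by
  intro (x : IncTuple 2) (y : IncTuple 2) h
  have h' : (x.1 1, x.1 0) = (y.1 1, y.1 0) := h
  refine Subtype.ext (funext fun i => ?_)
  fin_cases i
  · exact congrArg Prod.snd h'
  · exact congrArg Prod.fst h'

theorem incTuple_two_lt (x : IncTuple 2) : x.1 0 < x.1 1 := x.2 (by decide)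

theorem exists_incTuple_two {a b : ℝ} (h : a < b) : ∃ x : IncTuple 2, x.1 0 = a ∧ x.1 1 = b :=
  ⟨⟨![a, b], by rw [Fin.strictMono_iff_lt_succ]; intro i; fin_cases i; simpa using h⟩, rfl, rfl⟩

/-- The pairs of reals with `x ≤ y`. -/
abbrev LePair : Type := {p : ℝ × ℝ // p.1 ≤ p.2}

instance : MulAction DelannoyGroup LePair where
  smul g p := ⟨(g • p.1.1, g • p.1.2), g.monotone p.2⟩
  one_smul _ := Subtype.ext (Prod.ext (one_smul _ _) (one_smul _ _))
  mul_smul _ _ _ := Subtype.ext (Prod.ext (mul_smul _ _ _) (mul_smul _ _ _))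

/-- The relation `≤` of `ℝ`, as a `𝔾`-set. -/
def realLe : GSet DelannoyGroup where
  carrier := LePair
  smooth x := by
    classical
    exact isOpen_stabilizer x {x.1.1, x.1.2} fun g hg => Subtype.ext
      (Prod.ext (hg _ (by simp)) (hg _ (by simp)))
  finitary := finitary_of_reps (I := Fin 2)
    ![⟨((0 : ℝ), (1 : ℝ)), zero_le_one⟩, ⟨(0, 0), le_rfl⟩] fun x => by
      rcases x.2.lt_or_eq with h | h
      · obtain ⟨g, h1, h2⟩ := exists_smul_eq_pair zero_lt_one h
        exact ⟨0, g, Subtype.ext (Prod.ext h1 h2)⟩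
      · obtain ⟨g, h1⟩ := exists_smul_eq_real 0 x.1.1
        exact ⟨1, g, Subtype.ext (Prod.ext h1 (h1.trans h))⟩

/-- The inclusion of `≤` into `ℝ × ℝ`. -/
def realLeIncl : realLe ⟶ realPlane := GSet.Hom.mk (fun p : LePair => p.1) fun _ _ => rfl

/-- The inclusion of `<` into `≤`. -/
def realLtLe : realInc 2 ⟶ realLe :=
  GSet.Hom.mk (fun x : IncTuple 2 => (⟨(x.1 0, x.1 1), (incTuple_two_lt x).le⟩ : LePair))
    fun _ _ => rfl

/-- The inclusion of the diagonal into `≤`. -/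
def realEqLe : realLine ⟶ realLe :=
  GSet.Hom.mk (fun x : ℝ => (⟨(x, x), le_rfl⟩ : LePair)) fun _ _ => rfl

theorem realLe_isColimit : Nonempty (IsColimit (BinaryCofan.mk realLtLe realEqLe)) := by
  refine GSet.isColimit_of_compl _ _ (fun x y h => ?_) (fun x y h => ?_) (fun x y h => ?_) fun z => ?_
  · exact realLt_injective (congrArg Subtype.val h)
  · exact congrArg (fun p : LePair => p.1.1) h
  · have h1 : x.1 0 = y := congrArg (fun p : LePair => p.1.1) h
    have h2 : x.1 1 = y := congrArg (fun p : LePair => p.1.2) h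
    exact (incTuple_two_lt x).ne (h1.trans h2.symm)
  · obtain ⟨⟨a, b⟩, hab⟩ := z
    rcases lt_or_eq_of_le hab with h | h
    · obtain ⟨x, h1, h2⟩ := exists_incTuple_two h
      exact Or.inl ⟨x, Subtype.ext (Prod.ext h1 h2)⟩
    · exact Or.inr ⟨a, Subtype.ext (Prod.ext rfl h)⟩

theorem realPlane_isColimit : Nonempty (IsColimit (BinaryCofan.mk realLeIncl realGt)) := by
  refine GSet.isColimit_of_compl _ _ (fun x y h => Subtype.ext h) realGt_injective
    (fun x y h => ?_) fun z => ?_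
  · have h1 : x.1.1 = y.1 1 := congrArg (fun p : ℝ × ℝ => p.1) h
    have h2 : x.1.2 = y.1 0 := congrArg (fun p : ℝ × ℝ => p.2) h
    have h3 := x.2
    rw [h1, h2] at h3
    exact (incTuple_two_lt y).not_ge h3
  · obtain ⟨a, b⟩ := z
    rcases le_or_gt a b with h | h
    · exact Or.inl ⟨⟨(a, b), h⟩, rfl⟩
    · obtain ⟨x, h1, h2⟩ := exists_incTuple_two h
      exact Or.inr ⟨x, Prod.ext h2 h1⟩

/-- The map `[2] → [3]` that omits the last element. -/
def emb01 : Fin 2 ↪o Fin 3 := Fin.castSuccOrderEmb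

/-- The map `[2] → [3]` that omits the first element. -/
def emb12 : Fin 2 ↪o Fin 3 := Fin.succOrderEmb 2

/-- The map `[2] → [3]` that omits the middle element. -/
def emb02 : Fin 2 ↪o Fin 3 := Fin.succAboveOrderEmb 1

/-- `ℝ^(3)` is the fibre product of two copies of `ℝ^(2)`, over the middle coordinate. -/
theorem realInc_three_isPullback :
    IsPullback (realProj emb01) (realProj emb12) (realLt ≫ realSnd) (realLt ≫ realFst) := by
  have key : ∀ x y : IncTuple 2, x.1 1 = y.1 0 → StrictMono ![x.1 0, x.1 1, y.1 1] := by
    intro x y h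
    rw [Fin.strictMono_iff_lt_succ]
    intro i
    fin_cases i
    · exact incTuple_two_lt x
    · exact lt_of_eq_of_lt h (incTuple_two_lt y)
  refine ⟨⟨rfl⟩, ⟨PullbackCone.IsLimit.mk _
    (fun s => GSet.Hom.mk (fun t => (⟨_, key (GSet.Hom.toFun s.fst t) (GSet.Hom.toFun s.snd t)
        (congrArg (fun k => GSet.Hom.toFun k t) s.condition)⟩ : IncTuple 3)) fun g t => ?_)
    (fun s => GSet.hom_ext fun t => ?_) (fun s => GSet.hom_ext fun t => ?_) ?_⟩⟩
  · refine Subtype.ext (funext fun i => ?_)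
    have e1 := GSet.Hom.map_smul s.fst g t
    have e2 := GSet.Hom.map_smul s.snd g t
    fin_cases i
    · exact congrFun (congrArg Subtype.val e1) 0
    · exact congrFun (congrArg Subtype.val e1) 1
    · exact congrFun (congrArg Subtype.val e2) 1
  · refine Subtype.ext (funext fun i => ?_)
    fin_cases i <;> rfl
  · refine Subtype.ext (funext fun i => ?_)
    fin_cases i
    · exact congrArg (fun k => GSet.Hom.toFun k t) s.condition
    · rfl
  · intro s m h1 h2
    refine GSet.hom_ext fun t => Subtype.ext (funext fun i => ?_)
    have e1 : GSet.Hom.toFun (realProj emb01) (GSet.Hom.toFun m t) = GSet.Hom.toFun s.fst t :=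
      congrArg (fun k => GSet.Hom.toFun k t) h1
    have e2 : GSet.Hom.toFun (realProj emb12) (GSet.Hom.toFun m t) = GSet.Hom.toFun s.snd t :=
      congrArg (fun k => GSet.Hom.toFun k t) h2
    fin_cases i
    · exact congrFun (congrArg Subtype.val e1) 0
    · exact congrFun (congrArg Subtype.val e1) 1
    · exact congrFun (congrArg Subtype.val e2) 1

/-! ### Ordered objects of a lextensive category -/

section Ordered

set_option linter.unusedSectionVars false

variable {S : Type u} [Category.{v} S] [FinitaryExtensive S] [HasFiniteLimits S]

/-- The opposite of a binary relation: its image under the switching map. -/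
noncomputable def opRel {X : S} (R : Subobject (X ⨯ X)) : Subobject (X ⨯ X) :=
  (Subobject.map (prod.braiding X X).hom).obj R

/-- The diagonal of `X`, as a subobject of `X × X`. -/
noncomputable def diagRel (X : S) : Subobject (X ⨯ X) := Subobject.mk (diag X)

/-- A binary relation `R` on `X` is total if the natural map `R ⨿ Δ ⨿ Rᵒᵖ ⟶ X × X` is an
isomorphism. -/
def IsTotalRel {X : S} (R : Subobject (X ⨯ X)) : Prop :=
  IsIso (coprod.desc (coprod.desc R.arrow (diagRel X).arrow) (opRel R).arrow)

/-- The projection `X³ ⟶ X²` to the first and second coordinates. -/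
noncomputable def pr12 (X : S) : X ⨯ (X ⨯ X) ⟶ X ⨯ X :=
  prod.lift prod.fst (prod.snd ≫ prod.fst)

/-- The projection `X³ ⟶ X²` to the second and third coordinates. -/
noncomputable def pr23 (X : S) : X ⨯ (X ⨯ X) ⟶ X ⨯ X :=
  prod.lift (prod.snd ≫ prod.fst) (prod.snd ≫ prod.snd)

/-- The projection `X³ ⟶ X²` to the first and third coordinates. -/
noncomputable def pr13 (X : S) : X ⨯ (X ⨯ X) ⟶ X ⨯ X :=
  prod.lift prod.fst (prod.snd ≫ prod.snd)

/-- A binary relation `R` on `X` is transitive if `R₁₂ ∩ R₂₃ ⊆ R₁₃` in `X³`. -/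
def IsTransRel {X : S} (R : Subobject (X ⨯ X)) : Prop :=
  (Subobject.pullback (pr12 X)).obj R ⊓ (Subobject.pullback (pr23 X)).obj R ≤
    (Subobject.pullback (pr13 X)).obj R

variable (S) in
/-- A (totally) ordered object of the lextensive category `S`. -/
structure OrderedObject where
  obj : S
  rel : Subobject (obj ⨯ obj)
  total : IsTotalRel rel
  trans : IsTransRel rel

/-- A monotonic morphism of ordered objects: `R_X` is contained in the inverse image of `R_Y`. -/
@[ext]
structure OrderedObject.Hom (X Y : OrderedObject S) where
  hom : X.obj ⟶ Y.obj
  monotonic : X.rel ≤ (Subobject.pullback (prod.map hom hom)).obj Y.rel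

theorem monotonic_id (X : OrderedObject S) :
    X.rel ≤ (Subobject.pullback (prod.map (𝟙 X.obj) (𝟙 X.obj))).obj X.rel := by
  rw [prod.map_id_id, Subobject.pullback_id]

theorem monotonic_comp {X Y Z : OrderedObject S} (f : X.Hom Y) (g : Y.Hom Z) :
    X.rel ≤ (Subobject.pullback (prod.map (f.hom ≫ g.hom) (f.hom ≫ g.hom))).obj Z.rel := by
  rw [← prod.map_map, Subobject.pullback_comp]
  exact f.monotonic.trans ((Subobject.pullback _).monotone g.monotonic)

/-- The category `Ord(S)` of ordered objects of `S` and monotonic morphisms. -/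
instance : Category (OrderedObject S) where
  Hom := OrderedObject.Hom
  id X := ⟨𝟙 X.obj, monotonic_id X⟩
  comp f g := ⟨f.hom ≫ g.hom, monotonic_comp f g⟩
  id_comp _ := OrderedObject.Hom.ext (Category.id_comp _)
  comp_id _ := OrderedObject.Hom.ext (Category.comp_id _)
  assoc _ _ _ := OrderedObject.Hom.ext (Category.assoc _ _ _)

/-- The power `Xⁿ`. -/
noncomputable abbrev npow (X : S) (n : ℕ) : S := ∏ᶜ fun _ : Fin n => X

/-- The subobject `X^(n)` of `Xⁿ` "where the coordinates are strictly increasing": the intersection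
over all `i < j` of the inverse image of `R_X` under the projection to the coordinates `i, j`. -/
noncomputable def OrderedObject.incPower (X : OrderedObject S) (n : ℕ) :
    Subobject (npow X.obj n) :=
  (Finset.univ.filter fun p : Fin n × Fin n => p.1 < p.2).inf fun p =>
    (Subobject.pullback (prod.lift (Pi.π (fun _ : Fin n => X.obj) p.1)
      (Pi.π (fun _ : Fin n => X.obj) p.2))).obj X.rel

/-- An ordered object `X` is infinite-like if no `X^(n)`, `n ≥ 0`, is an initial object. -/
def OrderedObject.InfiniteLike (X : OrderedObject S) : Prop :=
  ∀ n : ℕ, IsEmpty (IsInitial (X.incPower n : S))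

/-- A relation represented by a monomorphism `r` is total if `r`, the diagonal and the switch of `r`
form a coproduct decomposition. -/
theorem isTotalRel_mk {X A : S} (r : A ⟶ X ⨯ X) [Mono r]
    (h : IsIso (coprod.desc (coprod.desc r (diag X)) (r ≫ (prod.braiding X X).hom))) :
    IsTotalRel (Subobject.mk r) := by
  have key : ∀ {B : S} (g : B ⟶ X ⨯ X) [Mono g] (P : Subobject (X ⨯ X)), P = Subobject.mk g →
      ∃ i : (P : S) ≅ B, P.arrow = i.hom ≫ g := by
    rintro B g _ _ rfl
    exact ⟨Subobject.underlyingIso g, (Subobject.underlyingIso_hom_comp_eq_mk g).symm⟩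
  obtain ⟨i1, h1⟩ := key r _ rfl
  obtain ⟨i2, h2⟩ := key (diag X) (diagRel X) rfl
  obtain ⟨i3, h3⟩ := key (r ≫ (prod.braiding X X).hom) (opRel (Subobject.mk r))
    (Subobject.map_mk r _)
  have e : coprod.desc (coprod.desc (Subobject.mk r).arrow (diagRel X).arrow)
      (opRel (Subobject.mk r)).arrow = coprod.map (coprod.map i1.hom i2.hom) i3.hom ≫
      coprod.desc (coprod.desc r (diag X)) (r ≫ (prod.braiding X X).hom) := by
    rw [h1, h2, h3, coprod.map_desc, coprod.map_desc]
  rw [IsTotalRel, e]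
  infer_instance

theorem isTransRel_mk {X A : S} (r : A ⟶ X ⨯ X) [Mono r]
    (h : ∀ (T : S) (a b : T ⟶ A), a ≫ r ≫ prod.snd = b ≫ r ≫ prod.fst →
      ∃ c : T ⟶ A, c ≫ r ≫ prod.fst = a ≫ r ≫ prod.fst ∧ c ≫ r ≫ prod.snd = b ≫ r ≫ prod.snd) :
    IsTransRel (Subobject.mk r) := by
  refine Subobject.le_of_factors ?_
  have h12 := (pullback_factors_iff _ _ _).1 (Subobject.inf_arrow_factors_left
    ((Subobject.pullback (pr12 X)).obj (Subobject.mk r))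
    ((Subobject.pullback (pr23 X)).obj (Subobject.mk r)))
  have h23 := (pullback_factors_iff _ _ _).1 (Subobject.inf_arrow_factors_right
    ((Subobject.pullback (pr12 X)).obj (Subobject.mk r))
    ((Subobject.pullback (pr23 X)).obj (Subobject.mk r)))
  rw [pullback_factors_iff]
  generalize ((Subobject.pullback (pr12 X)).obj (Subobject.mk r) ⊓
    (Subobject.pullback (pr23 X)).obj (Subobject.mk r)).arrow = f at h12 h23 ⊢
  obtain ⟨a, ha⟩ : ∃ a : _ ⟶ A, a ≫ r = f ≫ pr12 X := h12
  obtain ⟨b, hb⟩ : ∃ b : _ ⟶ A, b ≫ r = f ≫ pr23 X := h23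
  have a1 : a ≫ r ≫ prod.fst = f ≫ prod.fst := by
    rw [← Category.assoc, ha, Category.assoc]
    exact congrArg (f ≫ ·) (prod.lift_fst _ _)
  have a2 : a ≫ r ≫ prod.snd = f ≫ prod.snd ≫ prod.fst := by
    rw [← Category.assoc, ha, Category.assoc]
    exact congrArg (f ≫ ·) (prod.lift_snd _ _)
  have b1 : b ≫ r ≫ prod.fst = f ≫ prod.snd ≫ prod.fst := by
    rw [← Category.assoc, hb, Category.assoc]
    exact congrArg (f ≫ ·) (prod.lift_fst _ _)
  have b2 : b ≫ r ≫ prod.snd = f ≫ prod.snd ≫ prod.snd := by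
    rw [← Category.assoc, hb, Category.assoc]
    exact congrArg (f ≫ ·) (prod.lift_snd _ _)
  obtain ⟨c, hc1, hc2⟩ := h _ a b (a2.trans b1.symm)
  refine ⟨c, ?_⟩
  change c ≫ r = f ≫ pr13 X
  refine Limits.prod.hom_ext ?_ ?_
  · rw [Category.assoc, Category.assoc, hc1, a1]
    exact congrArg (f ≫ ·) (prod.lift_fst _ _).symm
  · rw [Category.assoc, Category.assoc, hc2, b2]
    exact congrArg (f ≫ ·) (prod.lift_snd _ _).symm

/-! ### Evaluation at `ℝ` -/

variable (S) in
/-- The functors `𝐒(𝔾) ⥤ S` that are left-exact (preserve finite limits) and additive (preserve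
finite coproducts). -/
def lexAdditive : ObjectProperty (GSet DelannoyGroup ⥤ S) := fun F =>
  PreservesFiniteLimits F ∧ PreservesFiniteCoproducts F

variable (S) in
/-- The category `LEx^⊕(𝐒(𝔾), S)` of additive left-exact functors and natural transformations. -/
abbrev LExAdd := (lexAdditive S).FullSubcategory

/-- The image of `ℝ^(2) ⊆ ℝ × ℝ` under `F`, as a map `F(ℝ^(2)) ⟶ F(ℝ) × F(ℝ)`. -/
noncomputable def evalLt (F : GSet DelannoyGroup ⥤ S) :
    F.obj (realInc 2) ⟶ F.obj realLine ⨯ F.obj realLine :=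
  prod.lift (F.map (realLt ≫ realFst)) (F.map (realLt ≫ realSnd))

/-- The comparison map `F(ℝ × ℝ) ⟶ F(ℝ) × F(ℝ)`. -/
noncomputable def evalPlane (F : GSet DelannoyGroup ⥤ S) :
    F.obj realPlane ⟶ F.obj realLine ⨯ F.obj realLine :=
  prod.lift (F.map realFst) (F.map realSnd)

theorem map_comp_evalPlane (F : GSet DelannoyGroup ⥤ S) {Y : GSet DelannoyGroup}
    (f : Y ⟶ realPlane) :
    F.map f ≫ evalPlane F = prod.lift (F.map (f ≫ realFst)) (F.map (f ≫ realSnd)) := by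
  rw [evalPlane, prod.comp_lift, F.map_comp, F.map_comp]

theorem isIso_evalPlane (F : GSet DelannoyGroup ⥤ S) [PreservesFiniteLimits F] :
    IsIso (evalPlane F) := by
  have l := mapIsLimitOfPreservesOfIsLimit F _ _ realPlane_isLimit.some
  have e : evalPlane F = (l.conePointUniqueUpToIso (prodIsProd _ _)).hom := by
    refine Limits.prod.hom_ext ?_ ?_
    · rw [evalPlane, prod.lift_fst]
      exact (l.conePointUniqueUpToIso_hom_comp (prodIsProd _ _) ⟨WalkingPair.left⟩).symm
    · rw [evalPlane, prod.lift_snd]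
      exact (l.conePointUniqueUpToIso_hom_comp (prodIsProd _ _) ⟨WalkingPair.right⟩).symm
  rw [e]
  infer_instance

instance mono_evalLt (F : GSet DelannoyGroup ⥤ S) [PreservesFiniteLimits F] : Mono (evalLt F) := by
  have := isIso_evalPlane F
  have := GSet.mono_of_injective _ realLt_injective
  rw [evalLt, ← map_comp_evalPlane]
  infer_instance

theorem isIso_desc_of_isColimit {A B C : S} {f : A ⟶ C} {g : B ⟶ C}
    (h : IsColimit (BinaryCofan.mk f g)) : IsIso (coprod.desc f g) := by
  have e : coprod.desc f g = ((coprodIsCoprod A B).coconePointUniqueUpToIso h).hom := by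
    refine coprod.hom_ext ?_ ?_
    · rw [coprod.inl_desc]
      exact ((coprodIsCoprod A B).comp_coconePointUniqueUpToIso_hom h ⟨WalkingPair.left⟩).symm
    · rw [coprod.inr_desc]
      exact ((coprodIsCoprod A B).comp_coconePointUniqueUpToIso_hom h ⟨WalkingPair.right⟩).symm
  rw [e]
  exact Iso.isIso_hom _

theorem evalLt_total (F : GSet DelannoyGroup ⥤ S) [PreservesFiniteLimits F]
    [PreservesFiniteCoproducts F] : IsTotalRel (Subobject.mk (evalLt F)) := by
  have := isIso_evalPlane F
  have i1 := isIso_desc_of_isColimit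
    (mapIsColimitOfPreservesOfIsColimit F _ _ realLe_isColimit.some)
  have i2 := isIso_desc_of_isColimit
    (mapIsColimitOfPreservesOfIsColimit F _ _ realPlane_isColimit.some)
  refine isTotalRel_mk _ ?_
  have e1 : evalLt F = F.map realLtLe ≫ F.map realLeIncl ≫ evalPlane F := by
    rw [map_comp_evalPlane, prod.comp_lift, ← F.map_comp, ← F.map_comp]
    rfl
  have e2 : diag (F.obj realLine) = F.map realEqLe ≫ F.map realLeIncl ≫ evalPlane F := by
    rw [map_comp_evalPlane, prod.comp_lift, ← F.map_comp, ← F.map_comp, diag, ← F.map_id]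
    rfl
  have e3 : evalLt F ≫ (prod.braiding _ _).hom = F.map realGt ≫ evalPlane F := by
    rw [map_comp_evalPlane, evalLt, prod.braiding_hom, prod.comp_lift, prod.lift_fst,
      prod.lift_snd]
    rfl
  have e : coprod.desc (coprod.desc (evalLt F) (diag _)) (evalLt F ≫ (prod.braiding _ _).hom) =
      coprod.map (coprod.desc (F.map realLtLe) (F.map realEqLe)) (𝟙 _) ≫
        coprod.desc (F.map realLeIncl) (F.map realGt) ≫ evalPlane F := by
    rw [e3, e2]
    ext <;> simp [e1]
  rw [e]
  infer_instance

theorem evalLt_trans (F : GSet DelannoyGroup ⥤ S) [PreservesFiniteLimits F] :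
    IsTransRel (Subobject.mk (evalLt F)) := by
  refine isTransRel_mk _ fun T a b h => ?_
  rw [evalLt, prod.lift_fst, prod.lift_snd] at *
  have hp := realInc_three_isPullback.map F
  refine ⟨hp.lift a b h ≫ F.map (realProj emb02), ?_, ?_⟩
  · rw [Category.assoc, ← F.map_comp]
    conv_rhs => rw [← hp.lift_fst a b h, Category.assoc, ← F.map_comp]
    rfl
  · rw [Category.assoc, ← F.map_comp]
    conv_rhs => rw [← hp.lift_snd a b h, Category.assoc, ← F.map_comp]
    rfl

/-- The ordered object `(F(ℝ), F(ℝ^(2)))` attached to an additive left-exact functor `F`. -/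
noncomputable def evalObj (F : LExAdd S) : OrderedObject S :=
  haveI := F.property.1
  haveI := F.property.2
  { obj := F.obj.obj realLine
    rel := Subobject.mk (evalLt F.obj)
    total := evalLt_total F.obj
    trans := evalLt_trans F.obj }

theorem eval_monotonic {F F' : LExAdd S} (η : F ⟶ F') :
    (evalObj F).rel ≤ (Subobject.pullback
      (prod.map (η.hom.app realLine) (η.hom.app realLine))).obj (evalObj F').rel := by
  have := F.property.1
  have := F'.property.1
  refine Subobject.mk_le_of_comm (Subobject.factorThru _ (evalLt F.obj)
    (pullback_factors _ _ _ ⟨η.hom.app (realInc 2), ?_⟩)) (Subobject.factorThru_arrow _ _ _)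
  change η.hom.app (realInc 2) ≫ evalLt F'.obj = evalLt F.obj ≫ _
  rw [evalLt, evalLt, prod.lift_map, prod.comp_lift, η.hom.naturality, η.hom.naturality]

variable (S) in
/-- Evaluation at `ℝ`: the functor `LEx^⊕(𝐒(𝔾), S) ⥤ Ord(S)`, `Ψ ↦ Ψ(ℝ)`. -/
noncomputable def evalReal : LExAdd S ⥤ OrderedObject S where
  obj F := evalObj F
  map η := OrderedObject.Hom.mk (η.hom.app realLine) (eval_monotonic η)
  map_id _ := rfl
  map_comp _ _ := rfl

end Ordered

end Delannoy

/-!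
Every open subgroup of `𝔾` is the pointwise stabilizer of a finite set of reals
(`exists_stabilizer_eq`): in a support of a point `x`, any real number that is missing from some
other support of `x` can be dropped (`Supports.erase`), so that `x` has a smallest support, and the
stabilizer of `x` preserves this finite set, hence fixes it pointwise. It follows that each `𝔾`-set
is a finite disjoint union of copies of the `ℝ^(n)`, and that the maps `ℝ^(n) → ℝ^(m)` are the
projections attached to the order embeddings `[m] → [n]` (`Decomposition.exists_factorization`). In
other words `𝐒(𝔾)` arises from the opposite of the category of the finite ordinals and order
embeddings by freely adding finite coproducts.

For an additive left-exact `Ψ`, iterated fibre products show that the points of `Ψ(ℝ^(n))` are the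
increasing `n`-tuples of points of `Ψ(ℝ)` (`existsUnique_point`). As `Ψ(Y)` is the coproduct of the
`Ψ(ℝ^(n))` over the orbits of `Y`, a natural transformation is the same as a monotonic map on the
values at `ℝ`, so that evaluation at `ℝ` is fully faithful. Moreover two different maps
`ℝ^(n) → Y` become equal under `Ψ` only if `Ψ(ℝ^(n)) = Ψ(ℝ)^(n)` is initial
(`isInitial_of_comp_map_eq`), which gives the criterion for `Ψ` to be faithful.

Conversely an ordered object `X` defines a functor that sends `Y` to the coproduct of the `X^(n)`
over the orbits of `Y`; this is the left Kan extension of `ℝ^(n) ↦ X^(n)`, and its universal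
property `exists_realize_desc` yields functoriality and additivity. Left-exactness is checked on
generalized elements, locally for the topology of finite coproduct decompositions, for which the
representable presheaves are sheaves. The order on the points of `X` is irreflexive over
non-initial objects, and totality says that any two points become comparable on the parts of a
decomposition (`comparableSieve_mem`). Hence finitely many points of values of the functor come, on
the parts of a decomposition, from a single point of some `X^(m)` and equivariant maps out of
`ℝ^(m)` (`exists_realizeIn_mem`). The equations of a cone then hold already between these
equivariant maps, and the limit in `𝐒(𝔾)` supplies the lift.
-/

namespace Delannoy

/-! ### Open subgroups of `𝔾` -/

/-- An automorphism that fixes `c` can be replaced by the identity to the right of `c`. -/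
theorem exists_eq_on_le_fix_ge (c : ℝ) (k : DelannoyGroup) (hk : k • c = c) :
    ∃ g : DelannoyGroup, (∀ t ≤ c, g • t = k • t) ∧ ∀ t, c ≤ t → g • t = t := by
  have hlt : ∀ t, t ≤ c ↔ k • t ≤ c := fun t => by
    conv_rhs => rw [← hk]
    exact k.le_iff_le.symm
  have hmono : StrictMono fun t : ℝ => if t ≤ c then k • t else t := by
    intro s t hst
    by_cases hs : s ≤ c <;> by_cases ht : t ≤ c <;> simp only [hs, ht, if_true, if_false]
    · exact (delannoy_smul_lt k).2 hst
    · exact ((hlt s).1 hs).trans_lt (not_le.1 ht)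
    · exact absurd (hst.le.trans ht) hs
    · exact hst
  have hsurj : Function.Surjective fun t : ℝ => if t ≤ c then k • t else t := by
    intro y
    by_cases hy : y ≤ c
    · have h1 : k⁻¹ • y ≤ c := by rw [hlt, smul_inv_smul]; exact hy
      exact ⟨k⁻¹ • y, by simp only [h1, if_true, smul_inv_smul]⟩
    · exact ⟨y, by simp only [hy, if_false]⟩
  refine ⟨hmono.orderIsoOfSurjective _ hsurj, fun t ht => if_pos ht, fun t ht => ?_⟩
  change (if t ≤ c then k • t else t) = t
  rcases ht.eq_or_lt with rfl | h
  · rw [if_pos le_rfl, hk]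
  · rw [if_neg (not_le.2 h)]

/-- An automorphism that is the identity outside of `(l, r)` and maps `p` to `q`. -/
theorem exists_fix_compl_Ioo_map {l p q r : ℝ} (hlp : l < p) (hlq : l < q) (hpr : p < r)
    (hqr : q < r) :
    ∃ g : DelannoyGroup, (∀ t, t ≤ l ∨ r ≤ t → g • t = t) ∧ g • p = q := by
  obtain ⟨k, hk, hkp⟩ := exists_fix_le_map l p q hlp hlq
  have hkr : q < k • r := by rw [← hkp]; exact (delannoy_smul_lt k).2 hpr
  obtain ⟨k', hk', hkr'⟩ := exists_fix_le_map q (k • r) r hkr hqr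
  obtain ⟨g, hg, hg'⟩ := exists_eq_on_le_fix_ge r (k' * k) (by rw [mul_smul, hkr'])
  refine ⟨g, ?_, ?_⟩
  · rintro t (ht | ht)
    · rw [hg t (ht.trans (hlp.trans hpr).le), mul_smul, hk t ht, hk' t (ht.trans hlq.le)]
    · exact hg' t ht
  · rw [hg p hpr.le, mul_smul, hkp, hk' q le_rfl]

/-- If no point of the finite set `C` lies in `[p, q]`, then some automorphism fixes `C` pointwise
and maps `p` to `q`. -/
theorem exists_fix_finset_map (C : Finset ℝ) {p q : ℝ} (hpq : p ≤ q)
    (hC : ∀ c ∈ C, c < p ∨ q < c) :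
    ∃ g : DelannoyGroup, (∀ c ∈ C, g • c = c) ∧ g • p = q := by
  have : ∃ l r : ℝ, l < p ∧ q < r ∧ ∀ c ∈ C, c ≤ l ∨ r ≤ c := by
    clear hpq
    induction C using Finset.induction_on with
    | empty => exact ⟨p - 1, q + 1, by linarith, by linarith, by simp⟩
    | insert c C _ ih =>
      obtain ⟨l, r, hl, hr, h⟩ := ih fun c hc => hC c (Finset.mem_insert_of_mem hc)
      refine ⟨if c < p then max l c else l, if q < c then min r c else r, ?_, ?_, ?_⟩
      · split_ifs with h1
        exacts [max_lt hl h1, hl]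
      · split_ifs with h1
        exacts [lt_min hr h1, hr]
      · intro d hd
        rcases Finset.mem_insert.1 hd with rfl | hd
        · rcases hC d (Finset.mem_insert_self _ _) with h1 | h1
          · left; rw [if_pos h1]; exact le_max_right _ _
          · right; rw [if_pos h1]; exact min_le_right _ _
        · rcases h d hd with h1 | h1
          · left; split_ifs
            exacts [h1.trans (le_max_left _ _), h1]
          · right; split_ifs
            exacts [(min_le_left _ _).trans h1, h1]
  obtain ⟨l, r, hl, hr, h⟩ := this
  obtain ⟨g, hg, hgp⟩ := exists_fix_compl_Ioo_map hl (hl.trans_le hpq) (hpq.trans_lt hr) hr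
  exact ⟨g, fun c hc => hg c (h c hc), hgp⟩

/-- A point outside of a finite set can be moved to the right, with the finite set fixed. -/
theorem exists_fix_finset_lt (C : Finset ℝ) {p : ℝ} (hp : p ∉ C) :
    ∃ g : DelannoyGroup, (∀ c ∈ C, g • c = c) ∧ p < g • p := by
  have : ∃ q, p < q ∧ ∀ c ∈ C, c < p ∨ q < c := by
    induction C using Finset.induction_on with
    | empty => exact ⟨p + 1, by linarith, by simp⟩
    | insert c C _ ih =>
      obtain ⟨q, hq, h⟩ := ih fun h => hp (Finset.mem_insert_of_mem h)
      have hcp : p ≠ c := fun h => hp (h ▸ Finset.mem_insert_self _ _)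
      rcases hcp.lt_or_gt with h1 | h1
      · refine ⟨min q ((p + c) / 2), lt_min hq (by linarith), fun d hd => ?_⟩
        rcases Finset.mem_insert.1 hd with rfl | hd
        · exact Or.inr ((min_le_right _ _).trans_lt (by linarith))
        · exact (h d hd).imp_right (min_le_left _ _).trans_lt
      · refine ⟨q, hq, fun d hd => ?_⟩
        rcases Finset.mem_insert.1 hd with rfl | hd
        exacts [Or.inl h1, h d hd]
  obtain ⟨q, hq, h⟩ := this
  obtain ⟨g, hg, rfl⟩ := exists_fix_finset_map C hq.le h
  exact ⟨g, hg, hq⟩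

section Support

variable {X : Type} [MulAction DelannoyGroup X]

/-- `A` supports `x` if every automorphism that fixes `A` pointwise fixes `x`. -/
def Supports (A : Finset ℝ) (x : X) : Prop :=
  ∀ g : DelannoyGroup, (∀ a ∈ A, g • a = a) → g • x = x

theorem Supports.smul_eq_smul {A : Finset ℝ} {x : X} (hA : Supports A x) {g h : DelannoyGroup}
    (e : ∀ a ∈ A, g • a = h • a) : g • x = h • x := by
  have := hA (h⁻¹ * g) fun a ha => by rw [mul_smul, e a ha, inv_smul_smul]
  rwa [mul_smul, inv_smul_eq_iff] at this

/-- If `A` and `B` support `x`, then the points of `A` outside of `B` can be removed from `A` one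
at a time: a point `a` that moves a little under the stabilizer of `B ∪ A \ {a}` can be moved to any
other position between its neighbours in `A` without moving `x`. -/
theorem Supports.erase {A B : Finset ℝ} {x : X} (hA : Supports A x) (hB : Supports B x) {a : ℝ}
    (haA : a ∈ A) (haB : a ∉ B) : Supports (A.erase a) x := by
  classical
  have main : ∀ h : DelannoyGroup, (∀ c ∈ A.erase a, h • c = c) → a < h • a → h • x = x := by
    intro h hh hah
    obtain ⟨k, hk, hka⟩ := exists_fix_finset_lt (B ∪ A.erase a) (p := a)
      (by simp [haB])
    have hkA : ∀ c ∈ A.erase a, k • c = c := fun c hc => hk c (Finset.mem_union_right _ hc)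
    have hkx : k • x = x := hB k fun c hc => hk c (Finset.mem_union_left _ hc)
    have hsep : ∀ g : DelannoyGroup, (∀ c ∈ A.erase a, g • c = c) → ∀ c ∈ A, a < c → g • a < c := by
      intro g hg c hc hac
      rw [← hg c (Finset.mem_erase.2 ⟨hac.ne', hc⟩)]
      exact (delannoy_smul_lt g).2 hac
    obtain ⟨g, hg, hgk⟩ : ∃ g : DelannoyGroup, (∀ c ∈ A, g • c = c) ∧ g • k • a = h • a := by
      have hC : ∀ c ∈ A, c < min (k • a) (h • a) ∨ max (k • a) (h • a) < c := by
        intro c hc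
        rcases le_or_gt c a with h1 | h1
        · exact Or.inl (h1.trans_lt (lt_min hka hah))
        · exact Or.inr (max_lt (hsep k hkA c hc h1) (hsep h hh c hc h1))
      obtain ⟨g, hg, hgm⟩ := exists_fix_finset_map A min_le_max hC
      rcases le_total (k • a) (h • a) with h1 | h1
      · rw [min_eq_left h1, max_eq_right h1] at hgm
        exact ⟨g, hg, hgm⟩
      · rw [min_eq_right h1, max_eq_left h1] at hgm
        refine ⟨g⁻¹, fun c hc => ?_, ?_⟩
        · rw [inv_smul_eq_iff, hg c hc]
        · rw [inv_smul_eq_iff, hgm]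
    have e : (g * k) • x = h • x := hA.smul_eq_smul fun c hc => by
      rw [mul_smul]
      rcases eq_or_ne c a with rfl | hca
      · exact hgk
      · have hc' := Finset.mem_erase.2 ⟨hca, hc⟩
        rw [hkA c hc', hg c hc, hh c hc']
    rw [← e, mul_smul, hkx, hA g hg]
  intro h hh
  rcases lt_trichotomy a (h • a) with h1 | h1 | h1
  · exact main h hh h1
  · refine hA h fun c hc => ?_
    rcases eq_or_ne c a with rfl | hca
    · exact h1.symm
    · exact hh c (Finset.mem_erase.2 ⟨hca, hc⟩)
  · have := main h⁻¹ (fun c hc => by rw [inv_smul_eq_iff, hh c hc])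
      ((delannoy_smul_lt h).1 (by rwa [smul_inv_smul]))
    rw [inv_smul_eq_iff] at this
    exact this.symm

/-- The open subgroups of `𝔾` are the pointwise stabilizers of finite sets: an open stabilizer is
the pointwise stabilizer of a smallest support. -/
theorem exists_stabilizer_eq (x : X)
    (hx : IsOpen (MulAction.stabilizer DelannoyGroup x : Set DelannoyGroup)) :
    ∃ A : Finset ℝ, ∀ g : DelannoyGroup, g • x = x ↔ ∀ a ∈ A, g • a = a := by
  classical
  have h0 : ∃ A : Finset ℝ, Supports A x := by
    obtain ⟨A, hA⟩ := hx 1 (one_smul _ x)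
    exact ⟨A, fun g hg => hA g fun a ha => by rw [hg a ha, one_smul]⟩
  obtain ⟨A, hA, hmin⟩ : ∃ A : Finset ℝ, Supports A x ∧
      ∀ B : Finset ℝ, Supports B x → ¬ B.card < A.card := by
    obtain ⟨A, hA, h⟩ := (measure (Finset.card (α := ℝ))).wf.has_min {A | Supports A x} h0
    exact ⟨A, hA, fun B hB => h B hB⟩
  have hsub : ∀ B : Finset ℝ, Supports B x → A ⊆ B := by
    intro B hB a ha
    by_contra haB
    exact hmin _ (hA.erase hB ha haB) (Finset.card_erase_lt_of_mem ha)
  refine ⟨A, fun g => ⟨fun hg => ?_, hA g⟩⟩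
  -- `g` maps the smallest support `A` of `x` onto itself, hence fixes it pointwise.
  have hsup : Supports (A.image (g • ·)) x := by
    intro h hh
    have := hA (g⁻¹ * h * g) fun a ha => by
      rw [mul_smul, mul_smul, hh _ (Finset.mem_image_of_mem _ ha), inv_smul_smul]
    rw [mul_smul, mul_smul, hg, inv_smul_eq_iff, hg] at this
    exact this
  have himg : A = A.image (g • ·) := Finset.eq_of_subset_of_card_le (hsub _ hsup)
    Finset.card_image_le
  have hmaps : ∀ a ∈ A, g • a ∈ A := fun a ha =>
    (Finset.ext_iff.1 himg _).2 (Finset.mem_image_of_mem _ ha)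
  let φ : A → A := fun a => ⟨g • a.1, hmaps a.1 a.2⟩
  have hφ : StrictMono φ := fun a b h => (delannoy_smul_lt g).2 h
  intro a ha
  have hsurj : Function.Surjective φ := Finite.surjective_of_injective hφ.injective
  have : hφ.orderIsoOfSurjective φ hsurj = OrderIso.refl _ := Subsingleton.elim _ _
  exact congrArg Subtype.val (congrArg (fun f => f ⟨a, ha⟩) this)

end Support

/-! ### Decomposition of `𝔾`-sets into orbits `ℝ^(n)` -/

/-- An equivariant map out of the transitive `𝔾`-set `ℝ^(n)` is determined by one value. -/
theorem realInc_hom_ext {n : ℕ} {Y : GSet DelannoyGroup} {f g : realInc n ⟶ Y} (α : IncTuple n)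
    (h : GSet.Hom.toFun f α = GSet.Hom.toFun g α) : f = g := by
  refine GSet.hom_ext fun t => ?_
  obtain ⟨k, rfl⟩ := incTuple_transitive n α t
  exact (GSet.Hom.map_smul f k α).trans ((congrArg (k • ·) h).trans (GSet.Hom.map_smul g k α).symm)

/-- The coordinate functions `ℝ^(n) → ℝ`. -/
def realCoord (n : ℕ) (i : Fin n) : realInc n ⟶ realLine :=
  GSet.Hom.mk (fun x : IncTuple n => x.1 i) fun _ _ => rfl

theorem realProj_comp_realCoord {m n : ℕ} (a : Fin m ↪o Fin n) (i : Fin m) :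
    realProj a ≫ realCoord m i = realCoord n (a i) := rfl

/-- The point `(0, …, n - 1)` of `ℝ^(n)`. -/
def stdTuple (n : ℕ) : IncTuple n := ⟨fun i => (i : ℕ), fun _ _ h => Nat.cast_lt.2 h⟩

/-- Every point of a `𝔾`-set is the image of a point of some `ℝ^(n)` under an injective map. -/
theorem exists_injective_hom_realInc (Y : GSet DelannoyGroup) (x : Y.carrier) :
    ∃ (n : ℕ) (e : realInc n ⟶ Y), Function.Injective (GSet.Hom.toFun e) ∧
      ∃ α : IncTuple n, GSet.Hom.toFun e α = x := by
  obtain ⟨A, hA⟩ := exists_stabilizer_eq x (Y.smooth x)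
  let α : IncTuple A.card := ⟨A.orderEmbOfFin rfl, (A.orderEmbOfFin rfl).strictMono⟩
  have hfix : ∀ g h : DelannoyGroup, g • α = h • α ↔ g • x = h • x := by
    intro g h
    have h1 : (h⁻¹ * g) • α = α ↔ (h⁻¹ * g) • x = x := by
      rw [hA]
      constructor
      · intro e a ha
        have : a ∈ Set.range (A.orderEmbOfFin rfl) := by rw [Finset.range_orderEmbOfFin]; exact ha
        obtain ⟨i, rfl⟩ := this
        exact congrFun (congrArg Subtype.val e) i
      · intro e
        exact Subtype.ext (funext fun i => e _ (Finset.orderEmbOfFin_mem A rfl i))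
    rwa [mul_smul, mul_smul, inv_smul_eq_iff, inv_smul_eq_iff] at h1
  choose γ hγ using incTuple_transitive A.card α
  refine ⟨A.card, GSet.Hom.mk (fun t : IncTuple A.card => γ t • x) ?_, ?_, α, ?_⟩
  · intro g (t : IncTuple A.card)
    change γ (g • t) • x = g • γ t • x
    rw [← mul_smul, ← hfix, hγ, mul_smul, hγ]
  · intro (s : IncTuple A.card) (t : IncTuple A.card) h
    have : γ s • α = γ t • α := (hfix _ _).2 h
    rwa [hγ, hγ] at this
  · change γ α • x = x
    have := (hfix (γ α) 1).1 (by rw [hγ, one_smul])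
    rwa [one_smul] at this

/-- A presentation of the `𝔾`-set `Y` as the disjoint union of finitely many `ℝ^(n)`, given by
equivariant maps `e i : ℝ^(n i) → Y` that are jointly bijective. -/
structure Decomposition (Y : GSet DelannoyGroup) where
  ι : Type
  fin : Finite ι
  n : ι → ℕ
  e : ∀ i, realInc (n i) ⟶ Y
  bij : Function.Bijective fun p : Σ i, IncTuple (n i) => GSet.Hom.toFun (e p.1) p.2

attribute [instance] Decomposition.fin

theorem nonempty_decomposition (Y : GSet DelannoyGroup) : Nonempty (Decomposition Y) := by
  choose n e he α hα using fun o : MulAction.orbitRel.Quotient DelannoyGroup Y.carrier =>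
    exists_injective_hom_realInc Y o.out
  refine ⟨⟨_, Y.finitary, n, e, ?_, ?_⟩⟩
  · have orb : ∀ o (s : IncTuple (n o)), Quotient.mk'' (GSet.Hom.toFun (e o) s) = o := by
      intro o s
      obtain ⟨g, rfl⟩ := incTuple_transitive _ (α o) s
      rw [← Quotient.out_eq' o]
      refine Quotient.sound' (MulAction.orbitRel_apply.2 ⟨g, ?_⟩)
      rw [Quotient.out_eq']
      exact ((GSet.Hom.map_smul (e o) g (α o)).trans (congrArg (g • ·) (hα o))).symm
    rintro ⟨o, s⟩ ⟨o', s'⟩ h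
    obtain rfl : o = o' := (orb o s).symm.trans ((congrArg Quotient.mk'' h).trans (orb o' s'))
    exact congrArg (Sigma.mk o) (he o h)
  · intro y
    have : MulAction.orbitRel DelannoyGroup Y.carrier y
        (Quotient.mk'' y : MulAction.orbitRel.Quotient DelannoyGroup Y.carrier).out :=
      Quotient.exact' (Quotient.out_eq' _).symm
    obtain ⟨g, hg⟩ := MulAction.orbitRel_apply.1 this
    exact ⟨⟨Quotient.mk'' y, g • α _⟩, (GSet.Hom.map_smul (e _) g (α _)).trans
      ((congrArg (g • ·) (hα _)).trans hg)⟩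

/-- A chosen presentation of a `𝔾`-set as a disjoint union of finitely many `ℝ^(n)`. -/
noncomputable def decomposition (Y : GSet DelannoyGroup) : Decomposition Y :=
  (nonempty_decomposition Y).some

namespace Decomposition

variable {Y : GSet DelannoyGroup} (D : Decomposition Y)

/-- A map `ℝ^(k) → Y` factors through one of the parts of `Y`, by a projection: the point of this
part that corresponds to the image of `(0, …, k - 1)` is fixed by the pointwise stabilizer of
`{0, …, k - 1}`, so that its coordinates belong to this set. -/
theorem exists_factorization {k : ℕ} (φ : realInc k ⟶ Y) :
    ∃ (i : D.ι) (a : Fin (D.n i) ↪o Fin k), realProj a ≫ D.e i = φ := by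
  classical
  obtain ⟨⟨i, β⟩, hβ : GSet.Hom.toFun (D.e i) β = GSet.Hom.toFun φ (stdTuple k)⟩ :=
    D.bij.2 (GSet.Hom.toFun φ (stdTuple k))
  have hfix : ∀ g : DelannoyGroup, g • stdTuple k = stdTuple k → g • β = β := by
    intro g hg
    have h1 : GSet.Hom.toFun (D.e i) (g • β) = GSet.Hom.toFun (D.e i) β := by
      refine (GSet.Hom.map_smul (D.e i) g β).trans ?_
      rw [hβ]
      exact (GSet.Hom.map_smul φ g (stdTuple k)).symm.trans (congrArg (GSet.Hom.toFun φ) hg)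
    exact eq_of_heq (Sigma.mk.inj (D.bij.1 (a₁ := ⟨i, g • β⟩) (a₂ := ⟨i, β⟩) h1)).2
  have hmem : ∀ j, ∃ l : Fin k, (stdTuple k).1 l = β.1 j := by
    intro j
    by_contra hj
    obtain ⟨g, hg, hgj⟩ := exists_fix_finset_lt (Finset.univ.image (stdTuple k).1) (p := β.1 j)
      (by simpa using hj)
    have := hfix g (Subtype.ext (funext fun l =>
      hg _ (Finset.mem_image_of_mem _ (Finset.mem_univ l))))
    exact hgj.ne (congrFun (congrArg Subtype.val this) j).symm
  choose a ha using hmem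
  have hmono : StrictMono a := fun j j' h =>
    (stdTuple k).2.lt_iff_lt.1 (by rw [ha, ha]; exact β.2 h)
  refine ⟨i, OrderEmbedding.ofStrictMono a hmono, realInc_hom_ext (stdTuple k) ?_⟩
  rw [← hβ]
  exact congrArg (GSet.Hom.toFun (D.e i)) (Subtype.ext (funext ha))

theorem factorization_unique {k : ℕ} {i i' : D.ι} {a : Fin (D.n i) ↪o Fin k}
    {a' : Fin (D.n i') ↪o Fin k} (h : realProj a ≫ D.e i = realProj a' ≫ D.e i') :
    (⟨i, a⟩ : Σ i, Fin (D.n i) ↪o Fin k) = ⟨i', a'⟩ := by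
  have h1 := D.bij.1 (a₁ := ⟨i, _⟩) (a₂ := ⟨i', _⟩)
    (congrArg (fun f => GSet.Hom.toFun f (stdTuple k)) h)
  obtain ⟨rfl, h2⟩ := Sigma.mk.inj h1
  have h3 := eq_of_heq h2
  refine congrArg (Sigma.mk i) (RelEmbedding.ext fun j => ?_)
  exact (stdTuple k).2.injective (congrFun (congrArg Subtype.val h3) j)

end Decomposition

/-! ### Covers by finite coproduct decompositions -/

section Covers

variable {S : Type u} [Category.{v} S] [FinitaryExtensive S]

theorem mem_extensiveTopology_of_isColimit {ι : Type} [Finite ι] {Z : ι → S} {c : Cofan Z}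
    (hc : IsColimit c) (R : Sieve c.pt) (h : ∀ i, R (c.inj i)) :
    R ∈ extensiveTopology S c.pt :=
  (extensiveTopology.mem_sieves_iff_contains_colimit_cofan R).2
    ⟨ι, inferInstance, Z, c.inj, ⟨hc⟩, h⟩

theorem mem_extensiveTopology_of_isInitial {T : S} (hT : IsInitial T) (R : Sieve T) :
    R ∈ extensiveTopology S T :=
  (extensiveTopology.mem_sieves_iff_contains_colimit_cofan R).2
    ⟨Empty, inferInstance, Empty.elim, fun i => i.elim,
      ⟨Cofan.IsColimit.mk _ (fun _ => hT.to _) (fun _ i => i.elim) fun _ _ _ => hT.hom_ext _ _⟩,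
      fun i => i.elim⟩

theorem mem_extensiveTopology_of_coprod {A B : S} (R : Sieve (A ⨿ B))
    (hA : R.pullback coprod.inl ∈ extensiveTopology S A)
    (hB : R.pullback coprod.inr ∈ extensiveTopology S B) : R ∈ extensiveTopology S (A ⨿ B) := by
  have hS : Sieve.ofArrows (pairFunction A B)
      (fun i => Cofan.inj (BinaryCofan.mk (coprod.inl : A ⟶ A ⨿ B) coprod.inr) i) ∈
        extensiveTopology S (A ⨿ B) :=
    mem_extensiveTopology_of_isColimit (Z := pairFunction A B) (coprodIsCoprod A B) _ fun i =>
      Sieve.ofArrows_mk _ _ i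
  have key : ∀ {A' : S} (j : A' ⟶ A ⨿ B) (_ : R.pullback j ∈ extensiveTopology S A') {Y : S}
      (g : Y ⟶ A'), R.pullback (g ≫ j) ∈ extensiveTopology S Y := fun j hj _ g => by
    rw [Sieve.pullback_comp]
    exact (extensiveTopology S).pullback_stable g hj
  refine (extensiveTopology S).transitive hS _ ?_
  rintro Y _ ⟨_, g, _, ⟨i⟩, rfl⟩
  cases i
  · exact key coprod.inl hA g
  · exact key coprod.inr hB g

theorem iInf_mem_extensiveTopology {T : S} {K : Type} [Finite K] (R : K → Sieve T)
    (h : ∀ k, R k ∈ extensiveTopology S T) : ⨅ k, R k ∈ extensiveTopology S T := by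
  classical
  have := Fintype.ofFinite K
  rw [← Finset.inf_univ_eq_iInf]
  induction (Finset.univ : Finset K) using Finset.induction_on with
  | empty => exact (extensiveTopology S).top_mem T
  | insert k s _ ih =>
    rw [Finset.inf_insert]
    exact (extensiveTopology S).intersection_covering (h k) ih

theorem eq_of_mem_extensiveTopology {T W : S} {R : Sieve T} (hR : R ∈ extensiveTopology S T)
    {w w' : T ⟶ W} (h : ∀ ⦃U : S⦄ (f : U ⟶ T), R f → f ≫ w = f ≫ w') : w = w' :=
  (extensiveTopology.isSheaf_yoneda_obj W R hR).isSeparatedFor.ext h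

/-- Compatible morphisms on a covering sieve glue, as representable presheaves are sheaves. -/
theorem exists_glue {T W : S} {R : Sieve T} (hR : R ∈ extensiveTopology S T)
    (l : ∀ ⦃U : S⦄ (f : U ⟶ T), R f → (U ⟶ W))
    (hl : ∀ ⦃U V : S⦄ (f : U ⟶ T) (g : V ⟶ U) (hf : R f),
      l (g ≫ f) (R.downward_closed hf g) = g ≫ l f hf) :
    ∃ L : T ⟶ W, ∀ ⦃U : S⦄ (f : U ⟶ T) (hf : R f), f ≫ L = l f hf := by
  let x : Presieve.FamilyOfElements (yoneda.obj W) R.arrows := fun U f hf => l f hf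
  have hx : x.SieveCompatible := fun U V f g hf => hl f g hf
  obtain ⟨L, hL, -⟩ := extensiveTopology.isSheaf_yoneda_obj W R hR x
    ((Presieve.compatible_iff_sieveCompatible x).2 hx)
  exact ⟨L, fun U f hf => hL f hf⟩

/-- The sieve of the arrows `f : U ⟶ T` for which `f ≫ g` factors through a part of a finite
coproduct is covering. -/
theorem exists_part_mem_extensiveTopology {ι : Type} [Finite ι] {Z : ι → S} {c : Cofan Z}
    (hc : IsColimit c) {T : S} (g : T ⟶ c.pt) (R : Sieve T)
    (h : ∀ ⦃U : S⦄ (f : U ⟶ T) (i : ι) (t : U ⟶ Z i), f ≫ g = t ≫ c.inj i → R f) :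
    R ∈ extensiveTopology S T := by
  have hS := mem_extensiveTopology_of_isColimit hc (Sieve.ofArrows Z c.inj)
    fun i => Sieve.ofArrows_mk _ _ i
  refine (extensiveTopology S).superset_covering ?_ ((extensiveTopology S).pullback_stable g hS)
  rintro U f ⟨_, t, _, ⟨i⟩, ht⟩
  exact h f i t ht.symm

/-- The parts of a coproduct are disjoint. -/
theorem isInitial_of_comp_inj_eq {ι : Type} [Finite ι] {Z : ι → S} {c : Cofan Z}
    (hc : IsColimit c) {i j : ι} (hij : i ≠ j) {T : S} (s : T ⟶ Z i) (t : T ⟶ Z j)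
    (h : s ≫ c.inj i = t ≫ c.inj j) : Nonempty (IsInitial T) := by
  have hp := FinitaryExtensive.isPullback_initial_to hc ⟨i⟩ ⟨j⟩ (by simpa using hij)
  have := initialIsInitial.isIso_to (hp.lift s t h)
  exact ⟨initialIsInitial.ofIso (asIso (hp.lift s t h)).symm⟩

end Covers

/-! ### The order on generalized elements -/

section Ordered

set_option linter.unusedSectionVars false

variable {S : Type u} [Category.{v} S] [FinitaryExtensive S] [HasFiniteLimits S]

/-- The relation on the `T`-valued points of an ordered object `X`. -/
def OrderedObject.Lt (X : OrderedObject S) {T : S} (x y : T ⟶ X.obj) : Prop :=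
  X.rel.Factors (prod.lift x y)

namespace OrderedObject

variable (X : OrderedObject S) {T : S} {x y z : T ⟶ X.obj}

variable {X} in
theorem Lt.comp (h : X.Lt x y) {U : S} (f : U ⟶ T) : X.Lt (f ≫ x) (f ≫ y) := by
  have := Subobject.factors_of_factors_right f h
  rwa [prod.comp_lift] at this

variable {X} in
theorem Lt.trans (h : X.Lt x y) (h' : X.Lt y z) : X.Lt x z := by
  have h0 : ((Subobject.pullback (pr12 X.obj)).obj X.rel ⊓
      (Subobject.pullback (pr23 X.obj)).obj X.rel).Factors (prod.lift x (prod.lift y z)) := by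
    rw [Subobject.inf_factors, pullback_factors_iff, pullback_factors_iff]
    constructor
    · simpa [pr12, Lt, prod.comp_lift, prod.lift_fst, prod.lift_snd, prod.lift_snd_assoc] using h
    · simpa [pr23, Lt, prod.comp_lift, prod.lift_fst, prod.lift_snd, prod.lift_snd_assoc] using h'
  have := (pullback_factors_iff _ _ _).1 (Subobject.factors_of_le _ X.trans h0)
  simpa [pr13, Lt, prod.comp_lift, prod.lift_fst, prod.lift_snd, prod.lift_snd_assoc] using this

/-- The relation is irreflexive on the points over a non-initial object. -/
theorem isInitial_of_lt_self (h : X.Lt x x) : Nonempty (IsInitial T) := by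
  have : IsIso _ := X.total
  have hd : (diagRel X.obj).Factors (prod.lift x x) := by
    rw [diagRel, Subobject.mk_factors_iff]
    exact ⟨x, by simp [diag, prod.comp_lift]⟩
  have e : (X.rel.factorThru _ h ≫ coprod.inl) ≫ coprod.inl ≫ coprod.desc (coprod.desc X.rel.arrow
        (diagRel X.obj).arrow) (opRel X.rel).arrow =
      ((diagRel X.obj).factorThru _ hd ≫ coprod.inr) ≫ coprod.inl ≫ coprod.desc (coprod.desc
        X.rel.arrow (diagRel X.obj).arrow) (opRel X.rel).arrow := by
    simp only [Category.assoc, coprod.inl_desc, coprod.inr_desc, Subobject.factorThru_arrow]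
    exact Subobject.factorThru_arrow _ _ _
  rw [← Category.assoc _ coprod.inl, ← Category.assoc _ coprod.inl, cancel_mono, cancel_mono] at e
  have hp := FinitaryExtensive.isPullback_initial_to_binaryCofan
    (coprodIsCoprod (X.rel : S) (diagRel X.obj : S))
  have := initialIsInitial.isIso_to (hp.lift _ _ e)
  exact ⟨initialIsInitial.ofIso (asIso (hp.lift _ _ e)).symm⟩

theorem opRel_factors_iff {Y : S} (R : Subobject (Y ⨯ Y)) (x y : T ⟶ Y) :
    (opRel R).Factors (prod.lift x y) ↔ R.Factors (prod.lift y x) := by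
  induction R using Subobject.ind with
  | h r =>
    rw [opRel, Subobject.map_mk, Subobject.mk_factors_iff, Subobject.mk_factors_iff]
    constructor
    · rintro ⟨g, hg⟩
      have hg : g ≫ r ≫ (prod.braiding Y Y).hom = prod.lift x y := hg
      refine ⟨g, ?_⟩
      change g ≫ r = _
      rw [← cancel_mono (prod.braiding Y Y).hom]
      refine (Category.assoc _ _ _).trans (hg.trans ?_)
      rw [prod.braiding_hom, prod.comp_lift, prod.lift_fst, prod.lift_snd]
    · rintro ⟨g, hg⟩
      have hg : g ≫ r = prod.lift y x := hg
      refine ⟨g, ?_⟩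
      change g ≫ r ≫ _ = _
      refine (Category.assoc _ _ _).symm.trans ((congrArg (· ≫ _) hg).trans ?_)
      rw [prod.braiding_hom, prod.comp_lift, prod.lift_fst, prod.lift_snd]

/-- The arrows to `T` over which the points `x` and `y` are comparable. -/
def comparableSieve (x y : T ⟶ X.obj) : Sieve T where
  arrows _ f := X.Lt (f ≫ x) (f ≫ y) ∨ f ≫ x = f ≫ y ∨ X.Lt (f ≫ y) (f ≫ x)
  downward_closed := by
    intro U V f h g
    simp only [Category.assoc]
    exact h.imp (fun h => h.comp g) (Or.imp (fun h => by rw [h]) fun h => h.comp g)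

/-- Any two points become comparable on the parts of a coproduct decomposition: this is totality. -/
theorem comparableSieve_mem (x y : T ⟶ X.obj) :
    X.comparableSieve x y ∈ extensiveTopology S T := by
  suffices h : X.comparableSieve prod.fst prod.snd ∈ extensiveTopology S (X.obj ⨯ X.obj) by
    have e : X.comparableSieve x y = (X.comparableSieve prod.fst prod.snd).pullback
        (prod.lift x y) := by
      ext U f
      simp [comparableSieve, prod.comp_lift, prod.lift_fst, prod.lift_snd]
    rw [e]
    exact (extensiveTopology S).pullback_stable _ h
  have : IsIso _ := X.total
  rw [← (extensiveTopology S).pullback_mem_iff_of_isIso (i := coprod.desc (coprod.desc X.rel.arrow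
        (diagRel X.obj).arrow) (opRel X.rel).arrow)]
  have top : ∀ {U V : S} {f : U ⟶ V} {R : Sieve V}, R f → R.pullback f ∈ extensiveTopology S U :=
    fun h => by
      rw [Sieve.pullback_eq_top_of_mem _ h]
      exact (extensiveTopology S).top_mem _
  have eta : ∀ {U : S} (f : U ⟶ X.obj ⨯ X.obj), prod.lift (f ≫ prod.fst) (f ≫ prod.snd) = f :=
    fun f => by ext <;> simp [prod.lift_fst, prod.lift_snd]
  refine mem_extensiveTopology_of_coprod _ ?_ ?_
  · rw [← Sieve.pullback_comp, coprod.inl_desc]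
    refine mem_extensiveTopology_of_coprod _ ?_ ?_
    · rw [← Sieve.pullback_comp, coprod.inl_desc]
      refine top (Or.inl ?_)
      rw [Lt, eta]
      exact Subobject.factors_self _
    · rw [← Sieve.pullback_comp, coprod.inr_desc]
      refine top (Or.inr (Or.inl ?_))
      rw [diagRel, ← Subobject.underlyingIso_hom_comp_eq_mk (diag X.obj)]
      simp [diag, prod.lift_fst, prod.lift_snd]
  · rw [← Sieve.pullback_comp, coprod.inr_desc]
    refine top (Or.inr (Or.inr ?_))
    rw [Lt, ← opRel_factors_iff, eta]
    exact Subobject.factors_self _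

/-! ### The objects `X^(n)` -/

/-- The object `X^(n)`. -/
noncomputable abbrev inc (n : ℕ) : S := (X.incPower n : S)

/-- The coordinates of `X^(n)`. -/
noncomputable def incπ (n : ℕ) (i : Fin n) : X.inc n ⟶ X.obj :=
  (X.incPower n).arrow ≫ Pi.π (fun _ : Fin n => X.obj) i

theorem incPower_factors_iff {n : ℕ} (f : T ⟶ npow X.obj n) :
    (X.incPower n).Factors f ↔ ∀ i j, i < j →
      X.Lt (f ≫ Pi.π (fun _ : Fin n => X.obj) i) (f ≫ Pi.π (fun _ : Fin n => X.obj) j) := by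
  simp only [incPower, Subobject.finset_inf_factors, pullback_factors_iff,
    prod.comp_lift, Finset.mem_filter, Finset.mem_univ, true_and, Prod.forall]
  rfl

theorem incπ_lt {n : ℕ} {i j : Fin n} (h : i < j) : X.Lt (X.incπ n i) (X.incπ n j) :=
  (X.incPower_factors_iff _).1 (Subobject.factors_self _) i j h

/-- The point of `X^(n)` with given increasing coordinates. -/
noncomputable def incLift {n : ℕ} (x : Fin n → (T ⟶ X.obj)) (h : ∀ i j, i < j → X.Lt (x i) (x j)) :
    T ⟶ X.inc n :=
  (X.incPower n).factorThru (Pi.lift x) ((X.incPower_factors_iff _).2 fun i j hij => by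
    simpa using h i j hij)

@[simp]
theorem incLift_incπ {n : ℕ} (x : Fin n → (T ⟶ X.obj)) (h : ∀ i j, i < j → X.Lt (x i) (x j))
    (i : Fin n) : X.incLift x h ≫ X.incπ n i = x i := by
  simp [incLift, incπ]

theorem inc_hom_ext {n : ℕ} {f g : T ⟶ X.inc n} (h : ∀ i, f ≫ X.incπ n i = g ≫ X.incπ n i) :
    f = g := by
  rw [← cancel_mono (X.incPower n).arrow]
  refine Pi.hom_ext _ _ fun i => ?_
  simpa [incπ] using h i

/-- The projection `X^(n) ⟶ X^(m)` attached to an order embedding `[m] → [n]`. -/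
noncomputable def incMap {m n : ℕ} (a : Fin m ↪o Fin n) : X.inc n ⟶ X.inc m :=
  X.incLift (fun i => X.incπ n (a i)) fun _ _ h => X.incπ_lt (a.strictMono h)

@[simp]
theorem incMap_incπ {m n : ℕ} (a : Fin m ↪o Fin n) (i : Fin m) :
    X.incMap a ≫ X.incπ m i = X.incπ n (a i) := by
  simp [incMap]

theorem incMap_comp {l m n : ℕ} (a : Fin l ↪o Fin m) (b : Fin m ↪o Fin n) :
    X.incMap b ≫ X.incMap a = X.incMap (a.trans b) :=
  X.inc_hom_ext fun i => by simp

theorem incMap_refl (n : ℕ) : X.incMap (RelEmbedding.refl _ : Fin n ↪o Fin n) = 𝟙 _ :=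
  X.inc_hom_ext fun i => by simp

/-- Different projections `X^(n) ⟶ X^(m)` agree only on an initial object. -/
theorem isInitial_of_comp_incMap_eq {m n : ℕ} {a b : Fin m ↪o Fin n} (hab : a ≠ b)
    (t : T ⟶ X.inc n) (h : t ≫ X.incMap a = t ≫ X.incMap b) : Nonempty (IsInitial T) := by
  obtain ⟨i, hi⟩ : ∃ i, a i ≠ b i := by
    by_contra! h
    exact hab (RelEmbedding.ext h)
  have e : t ≫ X.incπ n (a i) = t ≫ X.incπ n (b i) := by
    have := congrArg (· ≫ X.incπ m i) h
    simpa using this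
  rcases hi.lt_or_gt with h1 | h1
  · have := (X.incπ_lt h1).comp t
    rw [e] at this
    exact X.isInitial_of_lt_self this
  · have := (X.incπ_lt h1).comp t
    rw [e] at this
    exact X.isInitial_of_lt_self this

/-- Finitely many pairwise comparable points over a non-initial object are the coordinates, with
repetitions, of a point of some `X^(m)`. -/
theorem exists_chart (hT : IsEmpty (IsInitial T)) {K : Type} [Finite K] (z : K → (T ⟶ X.obj))
    (hz : ∀ k k', X.Lt (z k) (z k') ∨ z k = z k' ∨ X.Lt (z k') (z k)) :
    ∃ (m : ℕ) (r : T ⟶ X.inc m) (c : K → Fin m), (∀ k, r ≫ X.incπ m (c k) = z k) ∧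
      ∀ k k', X.Lt (z k) (z k') → c k < c k' := by
  classical
  let V := Set.range z
  have : Fintype V := Fintype.ofFinite V
  have irr : ∀ x : T ⟶ X.obj, ¬ X.Lt x x := fun x h =>
    not_nonempty_iff.2 hT (X.isInitial_of_lt_self h)
  let lt : V → V → Prop := fun x y => X.Lt x.1 y.1
  have tri : ∀ x y : V, lt x y ∨ x = y ∨ lt y x := by
    rintro ⟨_, k, rfl⟩ ⟨_, k', rfl⟩
    simpa [lt, Subtype.ext_iff] using hz k k'
  have sto : IsStrictTotalOrder V lt :=
    { trichotomous := fun x y h1 h2 => ((tri x y).resolve_left h1).resolve_right h2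
      irrefl := fun x => irr x.1
      trans := fun x y z h h' => OrderedObject.Lt.trans h h' }
  let lin : LinearOrder V := linearOrderOfSTO lt
  let e : Fin (Fintype.card V) ≃o V := Fintype.orderIsoFinOfCardEq V rfl
  refine ⟨_, X.incLift (fun i => (e i).1) fun i j h => e.strictMono h,
    fun k => e.symm ⟨z k, k, rfl⟩, fun k => by simp, fun k k' h => ?_⟩
  exact e.symm.strictMono (a := ⟨z k, k, rfl⟩) (b := ⟨z k', k', rfl⟩) h

/-- Finitely many points of powers `X^(n)` factor, on the parts of a coproduct decomposition,
through projections from a single `X^(m)`. -/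
theorem exists_common_chart_mem {J : Type} [Finite J] {n : J → ℕ} (t : ∀ j, T ⟶ X.inc (n j))
    (R : Sieve T) (h : ∀ ⦃U : S⦄ (f : U ⟶ T) (m : ℕ) (r : U ⟶ X.inc m)
      (a : ∀ j, Fin (n j) ↪o Fin m), IsEmpty (IsInitial U) →
      (∀ j, f ≫ t j = r ≫ X.incMap (a j)) → R f) :
    R ∈ extensiveTopology S T := by
  let z : (Σ j, Fin (n j)) → (T ⟶ X.obj) := fun k => t k.1 ≫ X.incπ _ k.2
  have hC : (⨅ p : (Σ j, Fin (n j)) × (Σ j, Fin (n j)), X.comparableSieve (z p.1) (z p.2)) ∈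
      extensiveTopology S T := iInf_mem_extensiveTopology _ fun p => X.comparableSieve_mem _ _
  refine (extensiveTopology S).transitive hC _ fun U f hf => ?_
  by_cases hU : Nonempty (IsInitial U)
  · exact mem_extensiveTopology_of_isInitial hU.some _
  rw [not_nonempty_iff] at hU
  have hf' : ∀ k k', X.comparableSieve (z k) (z k') f := fun k k' =>
    (iInf_le (fun p : (Σ j, Fin (n j)) × (Σ j, Fin (n j)) => X.comparableSieve (z p.1) (z p.2))
      (k, k') : _ ≤ _) f hf
  obtain ⟨m, r, c, hr, hc⟩ := X.exists_chart hU (fun k => f ≫ z k) hf'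
  have hcm : ∀ j, StrictMono fun i => c ⟨j, i⟩ := fun j i i' hi =>
    hc _ _ (((X.incπ_lt hi).comp (t j)).comp f)
  rw [Sieve.pullback_eq_top_of_mem]
  · exact (extensiveTopology S).top_mem _
  · refine h f m r (fun j => OrderEmbedding.ofStrictMono _ (hcm j)) hU fun j =>
      X.inc_hom_ext fun i => ?_
    have := hr ⟨j, i⟩
    simpa [z] using this.symm

end OrderedObject

end Ordered

/-! ### Limits and colimits in `𝐒(𝔾)` -/

/-- `ℝ^(0)` is the final `𝔾`-set. -/
noncomputable def realIncZeroIsTerminal : IsTerminal (realInc 0) :=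
  IsTerminal.ofUniqueHom
    (fun _ => GSet.Hom.mk (fun _ => (⟨fun i => i.elim0, fun i => i.elim0⟩ : IncTuple 0))
      fun _ _ => Subtype.ext (funext fun i => i.elim0))
    fun _ _ => GSet.hom_ext fun _ => Subtype.ext (funext fun i => i.elim0)

/-- The identification of `ℝ` with `ℝ^(1)`. -/
noncomputable def realIncOne : realLine ⟶ realInc 1 :=
  GSet.Hom.mk (fun x : ℝ => (⟨fun _ => x, fun i j h => absurd h (by omega)⟩ : IncTuple 1))
    fun _ _ => rfl

theorem realCoord_comp_realIncOne : realCoord 1 0 ≫ realIncOne = 𝟙 _ :=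
  GSet.hom_ext fun (x : IncTuple 1) => Subtype.ext (funext fun i =>
    congrArg x.1 (Subsingleton.elim 0 i))

instance : IsIso (realCoord 1 0) := ⟨realIncOne, realCoord_comp_realIncOne, rfl⟩

/-- `ℝ^(n + 2)` is the fibre product of `ℝ^(n + 1)` and `ℝ^(2)`, over the last but one
coordinate. -/
theorem realInc_isPullback (n : ℕ) :
    IsPullback (realProj (Fin.castSuccOrderEmb : Fin (n + 1) ↪o Fin (n + 2)))
      (realProj (Fin.natAddOrderEmb n : Fin 2 ↪o Fin (n + 2)))
      (realCoord (n + 1) (Fin.last n)) (realCoord 2 0) := by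
  have key : ∀ (x : IncTuple (n + 1)) (y : IncTuple 2), x.1 (Fin.last n) = y.1 0 →
      StrictMono (Fin.snoc x.1 (y.1 1) : Fin (n + 2) → ℝ) := by
    intro x y h
    rw [Fin.strictMono_iff_lt_succ]
    intro i
    induction i using Fin.lastCases with
    | last =>
      rw [Fin.succ_last, Fin.snoc_last, Fin.snoc_castSucc, h]
      exact incTuple_two_lt y
    | cast i =>
      rw [Fin.succ_castSucc, Fin.snoc_castSucc, Fin.snoc_castSucc]
      exact x.2 (Fin.castSucc_lt_succ)
  refine ⟨⟨rfl⟩, ⟨PullbackCone.IsLimit.mk _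
    (fun s => GSet.Hom.mk (fun t => (⟨_, key (GSet.Hom.toFun s.fst t) (GSet.Hom.toFun s.snd t)
        (congrArg (fun k => GSet.Hom.toFun k t) s.condition)⟩ : IncTuple (n + 2))) fun g t => ?_)
    (fun s => GSet.hom_ext fun t => ?_) (fun s => GSet.hom_ext fun t => ?_) ?_⟩⟩
  · refine Subtype.ext (funext fun i => ?_)
    induction i using Fin.lastCases with
    | last =>
      exact (Fin.snoc_last (α := fun _ => ℝ) _ _).trans
        ((congrFun (congrArg Subtype.val (GSet.Hom.map_smul s.snd g t)) 1).trans
          (congrArg (g • ·) (Fin.snoc_last (α := fun _ => ℝ) _ _).symm))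
    | cast i =>
      exact (Fin.snoc_castSucc (α := fun _ => ℝ) _ _ i).trans
        ((congrFun (congrArg Subtype.val (GSet.Hom.map_smul s.fst g t)) i).trans
          (congrArg (g • ·) (Fin.snoc_castSucc (α := fun _ => ℝ) _ _ i).symm))
  · refine Subtype.ext (funext fun i => ?_)
    exact Fin.snoc_castSucc (α := fun _ => ℝ) _ _ i
  · refine Subtype.ext (funext fun i => ?_)
    fin_cases i
    · exact (Fin.snoc_castSucc (α := fun _ => ℝ) _ _ (Fin.last n)).trans
        (congrArg (fun k => GSet.Hom.toFun k t) s.condition)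
    · exact Fin.snoc_last (α := fun _ => ℝ) _ _
  · intro s m h1 h2
    refine GSet.hom_ext fun t => Subtype.ext (funext fun i => ?_)
    have e1 : GSet.Hom.toFun (realProj Fin.castSuccOrderEmb) (GSet.Hom.toFun m t) =
      GSet.Hom.toFun s.fst t := congrArg (fun k => GSet.Hom.toFun k t) h1
    have e2 : GSet.Hom.toFun (realProj (Fin.natAddOrderEmb n)) (GSet.Hom.toFun m t) =
      GSet.Hom.toFun s.snd t := congrArg (fun k => GSet.Hom.toFun k t) h2
    induction i using Fin.lastCases with
    | last =>
      exact (congrFun (congrArg Subtype.val e2) 1).trans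
        (Fin.snoc_last (α := fun _ => ℝ) _ _).symm
    | cast i =>
      exact (congrFun (congrArg Subtype.val e1) i).trans
        (Fin.snoc_castSucc (α := fun _ => ℝ) _ _ i).symm

/-- A family of equivariant maps that is bijective on the disjoint union exhibits a
coproduct. -/
theorem isColimit_of_bijective {ι : Type} {Z : ι → GSet DelannoyGroup} {Y : GSet DelannoyGroup}
    (q : ∀ i, Z i ⟶ Y)
    (h : Function.Bijective fun p : Σ i, (Z i).carrier => GSet.Hom.toFun (q p.1) p.2) :
    Nonempty (IsColimit (Cofan.mk Y q)) := by
  let E := Equiv.ofBijective _ h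
  have hE : ∀ i x, E.symm (GSet.Hom.toFun (q i) x) = ⟨i, x⟩ := fun i x =>
    E.symm_apply_apply ⟨i, x⟩
  refine ⟨Cofan.IsColimit.mk _
    (fun s => GSet.Hom.mk (fun y => GSet.Hom.toFun (s.inj (E.symm y).1) (E.symm y).2)
      fun g y => ?_) (fun s i => GSet.hom_ext fun x => ?_) fun s m hm => GSet.hom_ext fun y => ?_⟩
  · obtain ⟨⟨i, x⟩, rfl⟩ := E.surjective y
    have e : g • E ⟨i, x⟩ = E ⟨i, g • x⟩ := (GSet.Hom.map_smul (q i) g x).symm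
    rw [e, E.symm_apply_apply, E.symm_apply_apply]
    exact GSet.Hom.map_smul (s.inj i) g x
  · change GSet.Hom.toFun (s.inj (E.symm (GSet.Hom.toFun (q i) x)).1)
      (E.symm (GSet.Hom.toFun (q i) x)).2 = _
    rw [hE]
  · obtain ⟨⟨i, x⟩, rfl⟩ := E.surjective y
    change _ = GSet.Hom.toFun (s.inj (E.symm (E ⟨i, x⟩)).1) (E.symm (E ⟨i, x⟩)).2
    rw [E.symm_apply_apply]
    exact congrArg (fun k => GSet.Hom.toFun k x) (hm i)

/-- The disjoint union of a finite family of `𝔾`-sets. -/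
def sigmaGSet {ι : Type} [Finite ι] (Z : ι → GSet DelannoyGroup) : GSet DelannoyGroup where
  carrier := Σ i, (Z i).carrier
  smooth := fun ⟨i, x⟩ => by
    have : MulAction.stabilizer DelannoyGroup (⟨i, x⟩ : Σ i, (Z i).carrier) =
        MulAction.stabilizer DelannoyGroup x := by
      ext g
      simp [MulAction.mem_stabilizer_iff, Sigma.smul_mk]
    rw [this]
    exact (Z i).smooth x
  finitary := by
    have := fun i => (Z i).finitary
    refine finitary_of_reps (I := Σ i, MulAction.orbitRel.Quotient DelannoyGroup (Z i).carrier)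
      (fun o => ⟨o.1, o.2.out⟩) fun ⟨i, x⟩ => ?_
    have : MulAction.orbitRel DelannoyGroup (Z i).carrier x
        (Quotient.mk'' x : MulAction.orbitRel.Quotient DelannoyGroup (Z i).carrier).out :=
      Quotient.exact' (Quotient.out_eq' _).symm
    obtain ⟨g, hg⟩ := MulAction.orbitRel_apply.1 this
    exact ⟨⟨i, Quotient.mk'' x⟩, g, congrArg (Sigma.mk i) hg⟩

/-- The inclusion of a part into the disjoint union. -/
def sigmaGSetι {ι : Type} [Finite ι] (Z : ι → GSet DelannoyGroup) (i : ι) : Z i ⟶ sigmaGSet Z :=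
  GSet.Hom.mk (fun x => (⟨i, x⟩ : Σ i, (Z i).carrier)) fun _ _ => rfl

theorem sigmaGSetι_bijective {ι : Type} [Finite ι] (Z : ι → GSet DelannoyGroup) :
    Function.Bijective fun p : Σ i, (Z i).carrier => GSet.Hom.toFun (sigmaGSetι Z p.1) p.2 :=
  Function.bijective_id

/-- As `ℝ^(k)` is transitive, its maps to a disjoint union go to one of the parts. -/
theorem exists_factorization_sigmaGSet {ι : Type} [Finite ι] (Z : ι → GSet DelannoyGroup) {k : ℕ}
    (φ : realInc k ⟶ sigmaGSet Z) :
    ∃ (i : ι) (ψ : realInc k ⟶ Z i), ψ ≫ sigmaGSetι Z i = φ := by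
  have hi : ∀ t : IncTuple k, (GSet.Hom.toFun φ t).1 = (GSet.Hom.toFun φ (stdTuple k)).1 := by
    intro t
    obtain ⟨g, rfl⟩ := incTuple_transitive k (stdTuple k) t
    have h := congrArg (fun p : Σ i, (Z i).carrier => p.1) (GSet.Hom.map_smul φ g (stdTuple k))
    exact h
  choose ψ hψ using fun t : IncTuple k => show ∃ x : (Z (GSet.Hom.toFun φ (stdTuple k)).1).carrier,
      GSet.Hom.toFun φ t = (⟨_, x⟩ : Σ i, (Z i).carrier) by
    rw [← hi t]
    exact ⟨_, rfl⟩
  refine ⟨_, GSet.Hom.mk ψ fun g t => ?_, GSet.hom_ext fun t => (hψ t).symm⟩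
  have h1 := (hψ (g • t)).symm.trans ((GSet.Hom.map_smul φ g t).trans (congrArg (g • ·) (hψ t)))
  exact eq_of_heq (Sigma.mk.inj h1).2

theorem sigmaGSet_factorization_unique {ι : Type} [Finite ι] (Z : ι → GSet DelannoyGroup) {k : ℕ}
    {i j : ι} {φ : realInc k ⟶ Z i} {ψ : realInc k ⟶ Z j}
    (h : φ ≫ sigmaGSetι Z i = ψ ≫ sigmaGSetι Z j) :
    (⟨i, φ⟩ : Σ i, realInc k ⟶ Z i) = ⟨j, ψ⟩ := by
  have h1 : ∀ t : IncTuple k, (⟨i, GSet.Hom.toFun φ t⟩ : Σ i, (Z i).carrier) =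
    ⟨j, GSet.Hom.toFun ψ t⟩ := fun t =>
      congrArg (fun f : realInc k ⟶ sigmaGSet Z => GSet.Hom.toFun f t) h
  obtain ⟨rfl, -⟩ := Sigma.mk.inj (h1 (stdTuple k))
  exact congrArg (Sigma.mk i) (GSet.hom_ext fun t => eq_of_heq (Sigma.mk.inj (h1 t)).2)

/-! ### The values of an additive left-exact functor -/

section Ordered

set_option linter.unusedSectionVars false

variable {S : Type u} [Category.{v} S] [FinitaryExtensive S] [HasFiniteLimits S]

/-- `Ψ(Y)` is the coproduct of the `Ψ(ℝ^(n))` that belong to the orbits of `Y`. -/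
theorem nonempty_isColimit_map_decomposition (F : GSet DelannoyGroup ⥤ S)
    [PreservesFiniteCoproducts F] {Y : GSet DelannoyGroup} (D : Decomposition Y) :
    Nonempty (IsColimit (Cofan.mk (F.obj Y) fun i => F.map (D.e i))) := by
  obtain ⟨h⟩ := isColimit_of_bijective D.e D.bij
  exact ⟨isColimitCofanMkObjOfIsColimit F _ _ h⟩

theorem map_realInc_hom_ext (F : GSet DelannoyGroup ⥤ S) [PreservesFiniteCoproducts F]
    {Y : GSet DelannoyGroup} {W : S} {f g : F.obj Y ⟶ W}
    (h : ∀ (k : ℕ) (φ : realInc k ⟶ Y), F.map φ ≫ f = F.map φ ≫ g) : f = g :=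
  Cofan.IsColimit.hom_ext (nonempty_isColimit_map_decomposition F (decomposition Y)).some _ _
    fun _ => h _ _

namespace OrderedObject.Hom

theorem lt {X Y : OrderedObject S} (f : X ⟶ Y) {T : S} {x y : T ⟶ X.obj} (h : X.Lt x y) :
    Y.Lt (x ≫ OrderedObject.Hom.hom f) (y ≫ OrderedObject.Hom.hom f) := by
  have := (pullback_factors_iff _ _ _).1
    (Subobject.factors_of_le _ (OrderedObject.Hom.monotonic f) h)
  rwa [prod.lift_map] at this

end OrderedObject.Hom

/-- A morphism is monotonic if it preserves the relation on generalized elements. -/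
theorem OrderedObject.monotonic_of_lt {X Y : OrderedObject S} (f : X.obj ⟶ Y.obj)
    (h : ∀ ⦃T : S⦄ (x y : T ⟶ X.obj), X.Lt x y → Y.Lt (x ≫ f) (y ≫ f)) :
    X.rel ≤ (Subobject.pullback (prod.map f f)).obj Y.rel := by
  refine Subobject.le_of_factors ?_
  have eta : X.rel.arrow = prod.lift (X.rel.arrow ≫ prod.fst) (X.rel.arrow ≫ prod.snd) := by
    ext <;> simp [prod.lift_fst, prod.lift_snd]
  have := h (X.rel.arrow ≫ prod.fst) (X.rel.arrow ≫ prod.snd) (by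
    rw [OrderedObject.Lt, ← eta]
    exact Subobject.factors_self _)
  rw [pullback_factors_iff, eta, prod.lift_map]
  exact this

section Eval

variable (Ψ : LExAdd S)

theorem evalObj_lt_iff {T : S} (x y : T ⟶ Ψ.obj.obj realLine) :
    (evalObj Ψ).Lt x y ↔ ∃ t : T ⟶ Ψ.obj.obj (realInc 2),
      t ≫ Ψ.obj.map (realCoord 2 0) = x ∧ t ≫ Ψ.obj.map (realCoord 2 1) = y := by
  have := Ψ.property.1
  have hm : Mono (evalLt Ψ.obj) := mono_evalLt Ψ.obj
  have : (evalObj Ψ).Lt x y ↔ ∃ t : T ⟶ Ψ.obj.obj (realInc 2), t ≫ evalLt Ψ.obj = prod.lift x y :=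
    Subobject.mk_factors_iff (evalLt Ψ.obj) (prod.lift x y)
  rw [this]
  refine exists_congr fun t => ⟨fun h => ⟨?_, ?_⟩, fun ⟨h1, h2⟩ => ?_⟩
  · have := congrArg (· ≫ prod.fst) h
    simp only [evalLt, Category.assoc, prod.lift_fst] at this
    exact this
  · have := congrArg (· ≫ prod.snd) h
    simp only [evalLt, Category.assoc, prod.lift_snd] at this
    exact this
  · rw [evalLt, prod.comp_lift, ← h1, ← h2]
    rfl

theorem evalObj_map_realCoord_lt {n : ℕ} {i j : Fin n} (h : i < j) :
    (evalObj Ψ).Lt (Ψ.obj.map (realCoord n i)) (Ψ.obj.map (realCoord n j)) := by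
  have hm : StrictMono ![i, j] := by
    rw [Fin.strictMono_iff_lt_succ]; intro l; fin_cases l; simpa using h
  refine (evalObj_lt_iff Ψ _ _).2 ⟨Ψ.obj.map (realProj (OrderEmbedding.ofStrictMono _ hm)), ?_, ?_⟩
  · rw [← Ψ.obj.map_comp, realProj_comp_realCoord]; rfl
  · rw [← Ψ.obj.map_comp, realProj_comp_realCoord]; rfl

/-- The points of `Ψ(ℝ^(n))` are the increasing `n`-tuples of points of `Ψ(ℝ)`. -/
theorem existsUnique_point (n : ℕ) {T : S} (x : Fin n → (T ⟶ Ψ.obj.obj realLine))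
    (h : ∀ i j, i < j → (evalObj Ψ).Lt (x i) (x j)) :
    ∃! t : T ⟶ Ψ.obj.obj (realInc n), ∀ i, t ≫ Ψ.obj.map (realCoord n i) = x i := by
  have := Ψ.property.1
  match n with
  | 0 =>
    have hT : IsTerminal (Ψ.obj.obj (realInc 0)) := realIncZeroIsTerminal.isTerminalObj Ψ.obj _
    exact ⟨hT.from T, fun i => i.elim0, fun _ _ => hT.hom_ext _ _⟩
  | 1 =>
    refine ⟨x 0 ≫ inv (Ψ.obj.map (realCoord 1 0)), fun i => ?_, fun t ht => ?_⟩
    · obtain rfl := Subsingleton.elim 0 i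
      simp
    · rw [← ht 0]
      simp
  | n + 2 =>
    have hp := (realInc_isPullback n).map Ψ.obj
    have hlt : ∀ i j : Fin (n + 1), i < j → (evalObj Ψ).Lt (x i.castSucc) (x j.castSucc) :=
      fun i j hij => h _ _ (Fin.castSucc_lt_castSucc_iff.2 hij)
    obtain ⟨a, ha, ha'⟩ := existsUnique_point (n + 1) (fun i => x i.castSucc) hlt
    obtain ⟨b, hb0, hb1⟩ := (evalObj_lt_iff Ψ _ _).1 (h _ _ (Fin.castSucc_lt_last (Fin.last n)))
    have hb : ∀ b' : T ⟶ Ψ.obj.obj (realInc 2),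
        b' ≫ Ψ.obj.map (realCoord 2 0) = x (Fin.last n).castSucc →
        b' ≫ Ψ.obj.map (realCoord 2 1) = x (Fin.last (n + 1)) → b' = b := by
      intro b' h0 h1
      have hm : Mono (evalLt Ψ.obj) := mono_evalLt Ψ.obj
      rw [← cancel_mono (evalLt Ψ.obj), evalLt, prod.comp_lift, prod.comp_lift]
      exact congrArg₂ prod.lift (h0.trans hb0.symm) (h1.trans hb1.symm)
    refine ⟨hp.lift a b ((ha _).trans hb0.symm), fun i => ?_, fun t ht => ?_⟩
    · induction i using Fin.lastCases with
      | last =>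
        have e : realCoord (n + 2) (Fin.last (n + 1)) =
          realProj (Fin.natAddOrderEmb n) ≫ realCoord 2 1 := rfl
        rw [e, Ψ.obj.map_comp, hp.lift_snd_assoc, hb1]
      | cast i =>
        have e : realCoord (n + 2) i.castSucc =
          realProj Fin.castSuccOrderEmb ≫ realCoord (n + 1) i := rfl
        rw [e, Ψ.obj.map_comp, hp.lift_fst_assoc, ha]
    · refine hp.hom_ext ?_ ?_
      · rw [hp.lift_fst]
        refine ha' _ fun i => ?_
        rw [Category.assoc, ← Ψ.obj.map_comp, ← ht]
        rfl
      · rw [hp.lift_snd]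
        refine hb _ ?_ ?_
        · rw [Category.assoc, ← Ψ.obj.map_comp, ← ht]
          rfl
        · rw [Category.assoc, ← Ψ.obj.map_comp, ← ht]
          rfl

theorem evalObj_point_ext {n : ℕ} {T : S} {s t : T ⟶ Ψ.obj.obj (realInc n)}
    (h : ∀ i, s ≫ Ψ.obj.map (realCoord n i) = t ≫ Ψ.obj.map (realCoord n i)) : s = t :=
  (existsUnique_point Ψ n (fun i => t ≫ Ψ.obj.map (realCoord n i)) fun _ _ hij =>
    (evalObj_map_realCoord_lt Ψ hij).comp t).unique h fun _ => rfl

/-- `Ψ(ℝ^(n))` is `Ψ(ℝ)^(n)`. -/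
theorem nonempty_iso_inc (n : ℕ) : Nonempty ((evalObj Ψ).inc n ≅ Ψ.obj.obj (realInc n)) := by
  obtain ⟨t, ht, -⟩ := existsUnique_point Ψ n ((evalObj Ψ).incπ n)
    fun _ _ h => (evalObj Ψ).incπ_lt h
  refine ⟨⟨t, (evalObj Ψ).incLift (fun i => Ψ.obj.map (realCoord n i))
    fun _ _ h => evalObj_map_realCoord_lt Ψ h, ?_, ?_⟩⟩
  · refine (evalObj Ψ).inc_hom_ext fun i => ?_
    rw [Category.assoc, Category.id_comp]
    exact (congrArg (t ≫ ·) ((evalObj Ψ).incLift_incπ _ _ _)).trans (ht i)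
  · refine evalObj_point_ext Ψ fun i => ?_
    rw [Category.assoc, Category.id_comp]
    exact (congrArg (_ ≫ ·) (ht i)).trans ((evalObj Ψ).incLift_incπ _ _ _)

/-- The images of different maps `ℝ^(k) → Y` under `Ψ` agree only on an initial object. -/
theorem isInitial_of_comp_map_eq {k : ℕ} {Y : GSet DelannoyGroup} {φ ψ : realInc k ⟶ Y}
    (h : φ ≠ ψ) {T : S} (t : T ⟶ Ψ.obj.obj (realInc k)) (ht : t ≫ Ψ.obj.map φ = t ≫ Ψ.obj.map ψ) :
    Nonempty (IsInitial T) := by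
  have := Ψ.property.2
  let D := decomposition Y
  obtain ⟨hc⟩ := nonempty_isColimit_map_decomposition Ψ.obj D
  obtain ⟨i, a, rfl⟩ := D.exists_factorization φ
  obtain ⟨j, b, rfl⟩ := D.exists_factorization ψ
  rw [Ψ.obj.map_comp, Ψ.obj.map_comp, ← Category.assoc, ← Category.assoc] at ht
  by_cases hij : i = j
  · subst hij
    have : Mono (Ψ.obj.map (D.e i)) := FinitaryExtensive.mono_ι hc ⟨i⟩
    rw [cancel_mono] at ht
    obtain ⟨l, hl⟩ : ∃ l, a l ≠ b l := by
      by_contra! hab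
      exact h (by rw [RelEmbedding.ext hab])
    have e : t ≫ Ψ.obj.map (realCoord k (a l)) = t ≫ Ψ.obj.map (realCoord k (b l)) := by
      have := congrArg (· ≫ Ψ.obj.map (realCoord _ l)) ht
      simpa only [Category.assoc, ← Ψ.obj.map_comp, realProj_comp_realCoord] using this
    rcases hl.lt_or_gt with h1 | h1
    · have h2 := (evalObj_map_realCoord_lt Ψ h1).comp t
      exact (evalObj Ψ).isInitial_of_lt_self (x := t ≫ Ψ.obj.map (realCoord k (b l))) (e ▸ h2)
    · have h2 := (evalObj_map_realCoord_lt Ψ h1).comp t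
      exact (evalObj Ψ).isInitial_of_lt_self (x := t ≫ Ψ.obj.map (realCoord k (b l))) (e ▸ h2)
  · exact isInitial_of_comp_inj_eq hc hij _ _ ht

theorem faithful_iff_infiniteLike : Ψ.obj.Faithful ↔ ((evalReal S).obj Ψ).InfiniteLike := by
  constructor
  · intro hF n
    by_contra hn
    rw [not_isEmpty_iff] at hn
    have h1 : IsInitial (Ψ.obj.obj (realInc n)) := hn.some.ofIso (nonempty_iso_inc Ψ n).some
    have := h1.isIso_to (Ψ.obj.map (realProj (Fin.castAddOrderEmb 2 : Fin n ↪o Fin (n + 2))))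
    have h2 : IsInitial (Ψ.obj.obj (realInc (n + 2))) := h1.ofIso
      (asIso (Ψ.obj.map (realProj (Fin.castAddOrderEmb 2 : Fin n ↪o Fin (n + 2))))).symm
    have h3 : realCoord (n + 2) 0 = realCoord (n + 2) 1 := Ψ.obj.map_injective (h2.hom_ext _ _)
    have h4 := congrArg (fun f => GSet.Hom.toFun f (stdTuple (n + 2))) h3
    exact absurd ((stdTuple (n + 2)).2.injective h4) (by simp)
  · intro hI
    refine ⟨fun {Y Z} f g hfg => GSet.hom_ext fun y => ?_⟩
    by_contra hy
    obtain ⟨n, e, -, α, hα⟩ := exists_injective_hom_realInc Y y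
    have hne : e ≫ f ≠ e ≫ g := by
      intro h
      rw [← hα] at hy
      exact hy (congrArg (fun k => GSet.Hom.toFun k α) h)
    obtain ⟨h⟩ := isInitial_of_comp_map_eq Ψ hne (𝟙 _) (by
      rw [Ψ.obj.map_comp, Ψ.obj.map_comp, hfg])
    exact (hI n).false (h.ofIso (nonempty_iso_inc Ψ n).some.symm)

end Eval

/-! ### Evaluation at `ℝ` is fully faithful -/

instance : (evalReal S).Faithful where
  map_injective {Ψ Ψ'} η θ h := by
    have := Ψ.property.2
    have h0 : η.hom.app realLine = θ.hom.app realLine := congrArg OrderedObject.Hom.hom h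
    have h1 : ∀ n, η.hom.app (realInc n) = θ.hom.app (realInc n) := fun n =>
      evalObj_point_ext Ψ' fun i => by rw [← η.hom.naturality, ← θ.hom.naturality, h0]
    refine ObjectProperty.hom_ext _ (NatTrans.ext (funext fun Y => ?_))
    refine map_realInc_hom_ext Ψ.obj fun k φ => ?_
    rw [η.hom.naturality, θ.hom.naturality, h1]

instance : (evalReal S).Full where
  map_surjective {Ψ Ψ'} f := by
    have := Ψ.property.2
    let f0 : Ψ.obj.obj realLine ⟶ Ψ'.obj.obj realLine := OrderedObject.Hom.hom f
    have hex : ∀ n, ∃ p : Ψ.obj.obj (realInc n) ⟶ Ψ'.obj.obj (realInc n),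
        ∀ i, p ≫ Ψ'.obj.map (realCoord n i) = Ψ.obj.map (realCoord n i) ≫ f0 := fun n =>
      (existsUnique_point Ψ' n _ fun i j hij =>
        OrderedObject.Hom.lt f (evalObj_map_realCoord_lt Ψ hij)).exists
    choose p hp using hex
    have hp_nat : ∀ {m n : ℕ} (a : Fin m ↪o Fin n),
        Ψ.obj.map (realProj a) ≫ p m = p n ≫ Ψ'.obj.map (realProj a) := fun {m n} a =>
      evalObj_point_ext Ψ' fun i => by
        rw [Category.assoc, Category.assoc, hp, ← Ψ'.obj.map_comp, ← Ψ.obj.map_comp_assoc,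
          realProj_comp_realCoord, hp]
    have hη : ∀ Y, ∃ η : Ψ.obj.obj Y ⟶ Ψ'.obj.obj Y,
        ∀ (k : ℕ) (φ : realInc k ⟶ Y), Ψ.obj.map φ ≫ η = p k ≫ Ψ'.obj.map φ := by
      intro Y
      obtain ⟨hc⟩ := nonempty_isColimit_map_decomposition Ψ.obj (decomposition Y)
      refine ⟨Cofan.IsColimit.desc hc fun i => p _ ≫ Ψ'.obj.map ((decomposition Y).e i),
        fun k φ => ?_⟩
      obtain ⟨i, a, rfl⟩ := (decomposition Y).exists_factorization φ
      have e : Ψ.obj.map ((decomposition Y).e i) ≫ Cofan.IsColimit.desc hc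
          (fun i => p _ ≫ Ψ'.obj.map ((decomposition Y).e i)) =
            p _ ≫ Ψ'.obj.map ((decomposition Y).e i) := Cofan.IsColimit.fac hc _ i
      rw [Ψ.obj.map_comp, Category.assoc, e, ← Category.assoc, hp_nat, Category.assoc,
        ← Ψ'.obj.map_comp]
    choose η hη using hη
    refine ⟨ObjectProperty.homMk { app := η, naturality := fun Y Z g => ?_ }, ?_⟩
    · refine map_realInc_hom_ext Ψ.obj fun k φ => ?_
      rw [← Ψ.obj.map_comp_assoc, hη, Ψ'.obj.map_comp, ← Category.assoc (p k), ← hη,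
        Category.assoc]
    · refine OrderedObject.Hom.ext ?_
      change η realLine = f0
      rw [← cancel_epi (Ψ.obj.map (realCoord 1 0)), hη, hp]

namespace OrderedObject

variable (X : OrderedObject S)

/-! ### The functor attached to an ordered object -/

/-- The value at `Y` of the functor attached to `X`: the coproduct of the `X^(n)`, one for each
orbit `ℝ^(n)` of `Y`. -/
noncomputable def realize (Y : GSet DelannoyGroup) : S :=
  ∐ fun i : (decomposition Y).ι => X.inc ((decomposition Y).n i)

/-- The inclusion of `X^(n)` that belongs to a part `ℝ^(n)` of `Y`. -/
noncomputable def realizeι (Y : GSet DelannoyGroup) (i : (decomposition Y).ι) :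
    X.inc ((decomposition Y).n i) ⟶ X.realize Y :=
  Sigma.ι (fun i : (decomposition Y).ι => X.inc ((decomposition Y).n i)) i

/-- The parts `X^(n)` exhibit `X(Y)` as their coproduct. -/
noncomputable def realizeIsColimit (Y : GSet DelannoyGroup) :
    IsColimit (Cofan.mk (X.realize Y) (X.realizeι Y)) :=
  coproductIsCoproduct _

/-- The map `X^(k) ⟶ X(Y)` induced by an equivariant map `φ : ℝ^(k) → Y`. It is defined by the
factorization of `φ` through a part of `Y`. -/
noncomputable def realizeIn {Y : GSet DelannoyGroup} {k : ℕ} (φ : realInc k ⟶ Y) :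
    X.inc k ⟶ X.realize Y :=
  X.incMap ((decomposition Y).exists_factorization φ).choose_spec.choose ≫ X.realizeι Y _

variable {Y Z : GSet DelannoyGroup}

theorem realizeIn_proj_comp_e {k : ℕ} (i : (decomposition Y).ι)
    (a : Fin ((decomposition Y).n i) ↪o Fin k) :
    X.realizeIn (realProj a ≫ (decomposition Y).e i) = X.incMap a ≫ X.realizeι Y i := by
  obtain ⟨i', a', h, h'⟩ : ∃ (i' : (decomposition Y).ι)
      (a' : Fin ((decomposition Y).n i') ↪o Fin k),
      realProj a' ≫ (decomposition Y).e i' = realProj a ≫ (decomposition Y).e i ∧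
        X.realizeIn (realProj a ≫ (decomposition Y).e i) = X.incMap a' ≫ X.realizeι Y i' :=
    ⟨_, _, ((decomposition Y).exists_factorization _).choose_spec.choose_spec, rfl⟩
  obtain ⟨rfl, h2⟩ := Sigma.mk.inj ((decomposition Y).factorization_unique h)
  obtain rfl := eq_of_heq h2
  exact h'

theorem realProj_refl (n : ℕ) : realProj (RelEmbedding.refl _ : Fin n ↪o Fin n) = 𝟙 _ := rfl

theorem realizeIn_e (i : (decomposition Y).ι) :
    X.realizeIn ((decomposition Y).e i) = X.realizeι Y i := by
  have := X.realizeIn_proj_comp_e i (RelEmbedding.refl _)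
  rwa [realProj_refl, Category.id_comp, incMap_refl, Category.id_comp] at this

theorem realizeIn_proj_comp {k l : ℕ} (a : Fin k ↪o Fin l) (φ : realInc k ⟶ Y) :
    X.realizeIn (realProj a ≫ φ) = X.incMap a ≫ X.realizeIn φ := by
  obtain ⟨i, b, rfl⟩ := (decomposition Y).exists_factorization φ
  have e : realProj a ≫ realProj b ≫ (decomposition Y).e i =
    realProj (b.trans a) ≫ (decomposition Y).e i := rfl
  rw [e, realizeIn_proj_comp_e, realizeIn_proj_comp_e, ← Category.assoc, incMap_comp]

theorem realize_hom_ext {W : S} {f g : X.realize Y ⟶ W}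
    (h : ∀ (k : ℕ) (φ : realInc k ⟶ Y), X.realizeIn φ ≫ f = X.realizeIn φ ≫ g) : f = g := by
  refine Cofan.IsColimit.hom_ext (X.realizeIsColimit Y) _ _ fun i => ?_
  have := h _ ((decomposition Y).e i)
  rwa [realizeIn_e] at this

/-- The universal property of `X(Y)`: it is the colimit of the `X^(k)` over all equivariant maps
`ℝ^(k) → Y`. -/
theorem exists_realize_desc {W : S} (m : ∀ {k : ℕ}, (realInc k ⟶ Y) → (X.inc k ⟶ W))
    (hm : ∀ {k l : ℕ} (a : Fin k ↪o Fin l) (φ : realInc k ⟶ Y),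
      m (realProj a ≫ φ) = X.incMap a ≫ m φ) :
    ∃ d : X.realize Y ⟶ W, ∀ (k : ℕ) (φ : realInc k ⟶ Y), X.realizeIn φ ≫ d = m φ := by
  refine ⟨Cofan.IsColimit.desc (X.realizeIsColimit Y) fun i => m ((decomposition Y).e i),
    fun k φ => ?_⟩
  obtain ⟨i, a, rfl⟩ := (decomposition Y).exists_factorization φ
  rw [realizeIn_proj_comp_e, Category.assoc, hm]
  exact congrArg (X.incMap a ≫ ·) (Cofan.IsColimit.fac (X.realizeIsColimit Y) _ i)

theorem exists_realizeMap (f : Y ⟶ Z) : ∃ d : X.realize Y ⟶ X.realize Z,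
    ∀ (k : ℕ) (φ : realInc k ⟶ Y), X.realizeIn φ ≫ d = X.realizeIn (φ ≫ f) :=
  X.exists_realize_desc (fun φ => X.realizeIn (φ ≫ f)) fun a φ => by
    rw [Category.assoc, realizeIn_proj_comp]

/-- The map `X(Y) ⟶ X(Z)` induced by an equivariant map `Y → Z`. -/
noncomputable def realizeMap (f : Y ⟶ Z) : X.realize Y ⟶ X.realize Z :=
  (X.exists_realizeMap f).choose

@[simp]
theorem realizeIn_realizeMap {k : ℕ} (φ : realInc k ⟶ Y) (f : Y ⟶ Z) :
    X.realizeIn φ ≫ X.realizeMap f = X.realizeIn (φ ≫ f) :=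
  (X.exists_realizeMap f).choose_spec k φ

/-- The functor attached to an ordered object. -/
noncomputable def realization : GSet DelannoyGroup ⥤ S where
  obj := X.realize
  map := X.realizeMap
  map_id Y := X.realize_hom_ext fun k φ => by simp
  map_comp f g := X.realize_hom_ext fun k φ => by
    rw [realizeIn_realizeMap, ← Category.assoc (X.realizeIn φ), realizeIn_realizeMap,
      realizeIn_realizeMap, Category.assoc]

/-! ### The functor is additive -/

theorem nonempty_isColimit_realizeMap {ι : Type} [Finite ι] (Z : ι → GSet DelannoyGroup) :
    Nonempty (IsColimit (Cofan.mk (X.realize (sigmaGSet Z))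
      fun i => X.realizeMap (sigmaGSetι Z i))) := by
  have hex : ∀ s : Cofan fun i => X.realize (Z i), ∃ d : X.realize (sigmaGSet Z) ⟶ s.pt,
      ∀ i, X.realizeMap (sigmaGSetι Z i) ≫ d = s.inj i := by
    intro s
    have hm : ∀ (k : ℕ) (φ : realInc k ⟶ sigmaGSet Z), ∃ m : X.inc k ⟶ s.pt,
        ∀ (i : ι) (ψ : realInc k ⟶ Z i), ψ ≫ sigmaGSetι Z i = φ →
          m = X.realizeIn ψ ≫ s.inj i := by
      intro k φ
      obtain ⟨i, ψ, rfl⟩ := exists_factorization_sigmaGSet Z φ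
      refine ⟨X.realizeIn ψ ≫ s.inj i, fun j χ h => ?_⟩
      obtain ⟨rfl, h2⟩ := Sigma.mk.inj (sigmaGSet_factorization_unique Z h)
      obtain rfl := eq_of_heq h2
      rfl
    choose m hm using hm
    obtain ⟨d, hd⟩ := X.exists_realize_desc (fun {k} φ => m k φ) fun {k l} a φ => by
      obtain ⟨i, ψ, rfl⟩ := exists_factorization_sigmaGSet Z φ
      rw [hm l _ i (realProj a ≫ ψ) (Category.assoc _ _ _), hm k _ i ψ rfl, realizeIn_proj_comp,
        Category.assoc]
    refine ⟨d, fun j => X.realize_hom_ext fun k φ => ?_⟩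
    rw [← Category.assoc, realizeIn_realizeMap, hd, hm k _ j φ rfl]
  choose d hd using hex
  refine ⟨Cofan.IsColimit.mk _ d hd fun s m hm => X.realize_hom_ext fun k φ => ?_⟩
  obtain ⟨i, ψ, rfl⟩ := exists_factorization_sigmaGSet Z φ
  rw [← realizeIn_realizeMap, Category.assoc, Category.assoc, hd]
  exact congrArg (_ ≫ ·) (hm i)

instance : PreservesFiniteCoproducts X.realization where
  preserves n := by
    refine ⟨fun {K} => ?_⟩
    let Z : Fin n → GSet DelannoyGroup := fun j => K.obj ⟨j⟩
    have e : Discrete.functor Z ≅ K := Discrete.natIsoFunctor.symm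
    have hc := (isColimit_of_bijective _ (sigmaGSetι_bijective Z)).some
    have : PreservesColimit (Discrete.functor Z) X.realization :=
      preservesColimit_of_preserves_colimit_cocone hc
        ((isColimitMapCoconeCofanMkEquiv X.realization Z (sigmaGSetι Z)).symm
          (X.nonempty_isColimit_realizeMap Z).some)
    exact preservesColimit_of_iso_diagram X.realization e

/-! ### The functor is left-exact -/

/-- Different maps `ℝ^(k) → Y` induce maps that agree only on an initial object. -/
theorem isInitial_of_comp_realizeIn_eq {k : ℕ} {φ ψ : realInc k ⟶ Y} (h : φ ≠ ψ) {T : S}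
    (t : T ⟶ X.inc k) (ht : t ≫ X.realizeIn φ = t ≫ X.realizeIn ψ) : Nonempty (IsInitial T) := by
  obtain ⟨i, a, rfl⟩ := (decomposition Y).exists_factorization φ
  obtain ⟨j, b, rfl⟩ := (decomposition Y).exists_factorization ψ
  rw [realizeIn_proj_comp_e, realizeIn_proj_comp_e, ← Category.assoc, ← Category.assoc] at ht
  by_cases hij : i = j
  · subst hij
    have : Mono (X.realizeι Y i) := FinitaryExtensive.mono_ι (X.realizeIsColimit Y) ⟨i⟩
    rw [cancel_mono] at ht
    exact X.isInitial_of_comp_incMap_eq (fun hab => h (by rw [hab])) t ht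
  · exact isInitial_of_comp_inj_eq (X.realizeIsColimit Y) hij _ _ ht

/-- On the parts of a coproduct decomposition, finitely many points of values `X(Y j)` are induced
by a single point of some `X^(m)` and equivariant maps `ℝ^(m) → Y j`. -/
theorem exists_realizeIn_mem {J : Type} [Finite J] {Y : J → GSet DelannoyGroup} {T : S}
    (u : ∀ j, T ⟶ X.realize (Y j)) (R : Sieve T)
    (h : ∀ ⦃U : S⦄ (f : U ⟶ T) (m : ℕ) (r : U ⟶ X.inc m) (φ : ∀ j, realInc m ⟶ Y j),
      IsEmpty (IsInitial U) → (∀ j, f ≫ u j = r ≫ X.realizeIn (φ j)) → R f) :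
    R ∈ extensiveTopology S T := by
  let part : ∀ j, Sieve T := fun j =>
    { arrows := fun U f => ∃ (i : (decomposition (Y j)).ι) (t : U ⟶ X.inc _),
        f ≫ u j = t ≫ X.realizeι (Y j) i
      downward_closed := by
        rintro U V f ⟨i, t, ht⟩ g
        exact ⟨i, g ≫ t, by rw [Category.assoc, ht, Category.assoc]⟩ }
  have hpart : ⨅ j, part j ∈ extensiveTopology S T := iInf_mem_extensiveTopology _ fun j =>
    exists_part_mem_extensiveTopology (X.realizeIsColimit (Y j)) (u j) _ fun U f i t e => ⟨i, t, e⟩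
  refine (extensiveTopology S).transitive hpart _ fun U f hf => ?_
  choose i t ht using fun j => (iInf_le part j : _ ≤ _) f hf
  refine X.exists_common_chart_mem t _ fun V g m r a hV hr => ?_
  refine h (g ≫ f) m r (fun j => realProj (a j) ≫ (decomposition (Y j)).e (i j)) hV fun j => ?_
  rw [Category.assoc, ht, realizeIn_proj_comp_e, ← Category.assoc, ← Category.assoc, hr]

section Limits

variable {J : Type} [SmallCategory J] [FinCategory J] {K : J ⥤ GSet DelannoyGroup} {c : Cone K}

/-- Uniqueness for the universal property of `X(lim K)`. -/
theorem realize_cone_hom_ext (hc : IsLimit c) {T : S} {w w' : T ⟶ X.realize c.pt}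
    (h : ∀ j, w ≫ X.realizeMap (c.π.app j) = w' ≫ X.realizeMap (c.π.app j)) : w = w' := by
  let R : Sieve T :=
    { arrows := fun U f => f ≫ w = f ≫ w'
      downward_closed := by
        intro U V f hf g
        rw [Category.assoc, hf, Category.assoc] }
  refine eq_of_mem_extensiveTopology (R := R) ?_ fun U f hf => hf
  refine X.exists_realizeIn_mem (J := Bool) (Y := fun _ => c.pt)
    (fun b => if b then w else w') R fun U f m r φ hU hr => ?_
  have h1 : f ≫ w = r ≫ X.realizeIn (φ true) := hr true
  have h2 : f ≫ w' = r ≫ X.realizeIn (φ false) := hr false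
  have : φ true = φ false := hc.hom_ext fun j => by
    by_contra hne
    refine not_nonempty_iff.2 hU (X.isInitial_of_comp_realizeIn_eq hne r ?_)
    rw [← realizeIn_realizeMap, ← realizeIn_realizeMap, ← Category.assoc, ← Category.assoc,
      ← h1, ← h2, Category.assoc, Category.assoc, h]
  change f ≫ w = f ≫ w'
  rw [h1, h2, this]

/-- Existence for the universal property of `X(lim K)`. -/
theorem exists_realize_lift (hc : IsLimit c) {T : S} (u : ∀ j, T ⟶ X.realize (K.obj j))
    (hu : ∀ {i j} (f : i ⟶ j), u i ≫ X.realizeMap (K.map f) = u j) :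
    ∃ w : T ⟶ X.realize c.pt, ∀ j, w ≫ X.realizeMap (c.π.app j) = u j := by
  let R : Sieve T :=
    { arrows := fun U f => ∃ w : U ⟶ X.realize c.pt,
        ∀ j, w ≫ X.realizeMap (c.π.app j) = f ≫ u j
      downward_closed := by
        rintro U V f ⟨w, hw⟩ g
        exact ⟨g ≫ w, fun j => by rw [Category.assoc, hw, Category.assoc]⟩ }
  have hR : R ∈ extensiveTopology S T := by
    refine X.exists_realizeIn_mem u R fun U f m r φ hU hr => ?_
    -- Over the non-initial object `U` the equivariant maps `φ j` themselves form a cone.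
    let s : Cone K :=
      { pt := realInc m
        π := { app := φ
               naturality := fun i j g => by
                by_contra hne
                refine not_nonempty_iff.2 hU (X.isInitial_of_comp_realizeIn_eq hne r ?_)
                have e : ((Functor.const J).obj (realInc m)).map g ≫ φ j = φ j :=
                  Category.id_comp _
                rw [e, ← realizeIn_realizeMap, ← Category.assoc, ← hr, ← hr, Category.assoc,
                  hu] } }
    refine ⟨r ≫ X.realizeIn (hc.lift s), fun j => ?_⟩
    rw [Category.assoc, realizeIn_realizeMap, hc.fac, hr]
  choose w hw using fun (U : S) (f : U ⟶ T) (hf : R f) => hf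
  obtain ⟨L, hL⟩ := exists_glue hR w fun U V f g hf => X.realize_cone_hom_ext hc fun j => by
    rw [hw, Category.assoc, Category.assoc, hw]
  refine ⟨L, fun j => eq_of_mem_extensiveTopology hR fun U f hf => ?_⟩
  rw [← Category.assoc, hL f hf, hw]

end Limits

instance : PreservesFiniteLimits X.realization where
  preservesFiniteLimits J _ _ := by
    refine ⟨fun {K} => ⟨fun {c} hc => ?_⟩⟩
    have hex : ∀ s : Cone (K ⋙ X.realization), ∃ w : s.pt ⟶ X.realize c.pt,
        ∀ j, w ≫ X.realizeMap (c.π.app j) = s.π.app j := fun s =>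
      X.exists_realize_lift hc s.π.app fun f => s.w f
    choose w hw using hex
    exact ⟨{ lift := w
             fac := hw
             uniq := fun s m hm => X.realize_cone_hom_ext hc fun j =>
              (hm j).trans (hw s j).symm }⟩

/-! ### Evaluation at `ℝ` is essentially surjective -/

/-- `X(ℝ^(n))` is `X^(n)`. -/
theorem isIso_realizeIn_id (n : ℕ) : IsIso (X.realizeIn (𝟙 (realInc n))) := by
  -- The presentation of `ℝ^(n)` by itself shows that maps `ℝ^(k) → ℝ^(n)` are projections.
  let D : Decomposition (realInc n) :=
    { ι := Unit
      fin := inferInstance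
      n := fun _ => n
      e := fun _ => 𝟙 _
      bij := ⟨fun ⟨_, _⟩ ⟨_, _⟩ h => congrArg (Sigma.mk ()) h, fun x => ⟨⟨(), x⟩, rfl⟩⟩ }
  choose a ha using fun {k : ℕ} (φ : realInc k ⟶ realInc n) =>
    show ∃ a : Fin n ↪o Fin k, realProj a = φ from
      let ⟨_, a, h⟩ := D.exists_factorization φ
      ⟨a, h⟩
  have ha' : ∀ {k : ℕ} (b : Fin n ↪o Fin k), a (realProj b) = b := fun {k} b =>
    eq_of_heq (Sigma.mk.inj (D.factorization_unique (i := ()) (i' := ()) (ha (realProj b)))).2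
  obtain ⟨d, hd⟩ := X.exists_realize_desc (fun φ => X.incMap (a φ)) fun b φ => by
    rw [incMap_comp, ← ha' ((a φ).trans b)]
    congr 2
    conv_lhs => rw [← ha φ]
    rfl
  refine ⟨d, ?_, X.realize_hom_ext fun k φ => ?_⟩
  · rw [hd, ← realProj_refl, ha', incMap_refl]
  · rw [← Category.assoc, hd, ← realizeIn_proj_comp, ha, Category.comp_id, Category.comp_id]

/-- The additive left-exact functor attached to an ordered object. -/
noncomputable def realizationLEx : LExAdd S :=
  ⟨X.realization, inferInstance, inferInstance⟩

/-- The comparison map from `X` to the value at `ℝ` of the functor attached to `X`. -/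
noncomputable def toRealize : X.obj ⟶ X.realize realLine :=
  X.incLift (n := 1) (fun _ => 𝟙 X.obj) (fun i j h => absurd h (by omega)) ≫
    X.realizeIn (realCoord 1 0)

theorem incπ_toRealize (n : ℕ) (i : Fin n) :
    X.incπ n i ≫ X.toRealize = X.realizeIn (realCoord n i) := by
  have hm : StrictMono fun _ : Fin 1 => i := fun j k h => absurd h (by omega)
  have e : realCoord n i = realProj (OrderEmbedding.ofStrictMono _ hm) ≫ realCoord 1 0 := rfl
  rw [e, realizeIn_proj_comp, toRealize, ← Category.assoc]
  congr 1
  refine X.inc_hom_ext fun j => ?_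
  rw [Category.assoc, incLift_incπ, incMap_incπ, Category.comp_id]
  rfl

instance : IsIso X.toRealize := by
  have h1 : IsIso (X.incπ 1 0) :=
    ⟨X.incLift (n := 1) (fun _ => 𝟙 X.obj) (fun i j h => absurd h (by omega)),
      X.inc_hom_ext fun j => by
        obtain rfl := Subsingleton.elim 0 j
        rw [Category.assoc, incLift_incπ, Category.comp_id, Category.id_comp],
      X.incLift_incπ _ _ _⟩
  have h2 := X.isIso_realizeIn_id 1
  have h3 : IsIso (X.realizeMap (realCoord 1 0)) :=
    inferInstanceAs (IsIso (X.realization.map (realCoord 1 0)))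
  have e : X.incπ 1 0 ≫ X.toRealize =
      X.realizeIn (𝟙 (realInc 1)) ≫ X.realizeMap (realCoord 1 0) := by
    rw [incπ_toRealize, realizeIn_realizeMap, Category.id_comp]
  have : IsIso (X.incπ 1 0 ≫ X.toRealize) := by rw [e]; infer_instance
  exact IsIso.of_isIso_comp_left (X.incπ 1 0) _

theorem lt_toRealize_iff {T : S} (x y : T ⟶ X.obj) :
    (evalObj X.realizationLEx).Lt (x ≫ X.toRealize) (y ≫ X.toRealize) ↔ X.Lt x y := by
  refine (evalObj_lt_iff X.realizationLEx _ _).trans ?_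
  have key : ∀ (t : T ⟶ X.inc 2) (i : Fin 2),
      (t ≫ X.realizeIn (𝟙 (realInc 2))) ≫ X.realizeMap (realCoord 2 i) =
        (t ≫ X.incπ 2 i) ≫ X.toRealize := fun t i => by
    rw [Category.assoc, realizeIn_realizeMap, Category.id_comp, Category.assoc, incπ_toRealize]
  constructor
  · rintro ⟨(t : T ⟶ X.realize (realInc 2)), h0, h1⟩
    have := X.isIso_realizeIn_id 2
    obtain ⟨s, rfl⟩ : ∃ s : T ⟶ X.inc 2, s ≫ X.realizeIn (𝟙 (realInc 2)) = t :=
      ⟨t ≫ inv (X.realizeIn (𝟙 (realInc 2))), by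
        rw [Category.assoc, IsIso.inv_hom_id, Category.comp_id]⟩
    have h0 : s ≫ X.incπ 2 0 = x := (cancel_mono X.toRealize).1 ((key _ 0).symm.trans h0)
    have h1 : s ≫ X.incπ 2 1 = y := (cancel_mono X.toRealize).1 ((key _ 1).symm.trans h1)
    rw [← h0, ← h1]
    exact (X.incπ_lt (by decide)).comp _
  · intro h
    have hm : ∀ i j : Fin 2, i < j → X.Lt (![x, y] i) (![x, y] j) := by
      intro i j hij
      obtain ⟨rfl, rfl⟩ : i = 0 ∧ j = 1 := by omega
      exact h
    refine ⟨X.incLift ![x, y] hm ≫ X.realizeIn (𝟙 (realInc 2)), ?_, ?_⟩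
    · exact (key _ 0).trans (by rw [incLift_incπ]; rfl)
    · exact (key _ 1).trans (by rw [incLift_incπ]; rfl)

/-- An ordered object is recovered from the functor attached to it. -/
noncomputable def evalRealizationIso : (evalReal S).obj X.realizationLEx ≅ X where
  hom := OrderedObject.Hom.mk (X := evalObj X.realizationLEx)
    (inv X.toRealize : X.realize realLine ⟶ X.obj)
    (OrderedObject.monotonic_of_lt _ fun T (x y : T ⟶ X.realize realLine) h => by
      have e : ∀ z : T ⟶ X.realize realLine, (z ≫ inv X.toRealize) ≫ X.toRealize = z := by simp
      exact (X.lt_toRealize_iff _ _).1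
        ((congrArg₂ (evalObj X.realizationLEx).Lt (e x) (e y)).mpr h))
  inv := OrderedObject.Hom.mk (Y := evalObj X.realizationLEx) X.toRealize
    (OrderedObject.monotonic_of_lt _ fun T x y h => (X.lt_toRealize_iff x y).2 h)
  hom_inv_id := OrderedObject.Hom.ext (IsIso.inv_hom_id X.toRealize)
  inv_hom_id := OrderedObject.Hom.ext (IsIso.hom_inv_id X.toRealize)

end OrderedObject

instance : (evalReal S).EssSurj where
  mem_essImage X := ⟨X.realizationLEx, ⟨X.evalRealizationIso⟩⟩

end Ordered

end Delannoy

theorem mainTheorem3 (S : Type u) [Category.{v} S] [FinitaryExtensive S] [HasFiniteLimits S] :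
    (Delannoy.evalReal S).IsEquivalence ∧
      ∀ Ψ : Delannoy.LExAdd S,
        Ψ.obj.Faithful ↔ ((Delannoy.evalReal S).obj Ψ).InfiniteLike :=
  ⟨{ }, Delannoy.faithful_iff_infiniteLike⟩
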